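/- Let $\Omega\subset\mathbb{R}^2$ be a bounded Lipschitz domain. Let $A_0(\Omega)$ be the set of the vector fields $m\in BV(\Omega,\mathbb{R}^2)$ such that $|m|=1$ a.e. in $\Omega$, $\nabla\cdot m=0$ in the sense of distributions on $\Omega$, and $m\cdot n=0$ a.e. on $\partial\Omega$ in the sense of traces, where $n$ is the exterior unit normal. For $f:[0,2]\to[0,+\infty]$ and $m\in A_0(\Omega)$ put $$\mathcal I_f(m)=\int_{J(m)} f(|m_+-m_-|)\,d\mathcal H^1,$$ where $J(m)\subset\Omega$ is the jump set of $m$ and $m_\pm$ are the traces of $m$ on its two sides. The viscosity solution on $\Omega$ is $m_0=(\nabla\varphi_0)^\perp$, where $\varphi_0(x)=\operatorname{dist}(x,\partial\Omega)$ and $\perp$ is the rotation by $\pi/2$. For $0<|\theta|<\pi/2$ let $B$ be the point of intersection of the tangents to the unit circle $\mathcal C\subset\mathbb{R}^2=\mathbb{C}$ at $e^{i\theta}$ and $e^{-i\theta}$, that is $B=1/\cos\theta$, and let the convex domain $\Omega_\theta$ be the interior of the convex hull of $\mathcal C\cup\{B\}$. Let $p<1$ be a real number and $f(t)=t^p$.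 Then there exists $\theta_0\in\,]0,\pi/2[$, depending only on $p$, such that for every $\theta$ with $0<|\theta|<\theta_0$ the viscosity solution $m_0$ on $\Omega_\theta$ belongs to $A_0(\Omega_\theta)$ and is not a minimizer of $\mathcal I_f$ on $A_0(\Omega_\theta)$. -/

import Mathlib

open MeasureTheory Filter Topology Set

noncomputable section

namespace LineEnergy

/-! The plane `ℝ²` is identified with `ℂ`: real inner product, Lebesgue measure `volume`,
one-dimensional Hausdorff measure `μH[1]`; rotation by `π / 2` is multiplication by `I`. -/

/-- Smooth real test functions with compact support in the open set `Ω`. -/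
structure IsTest (Ω : Set ℂ) (ψ : ℂ → ℝ) : Prop where
  smooth : ContDiff ℝ (⊤ : ℕ∞) ψ
  compact : HasCompactSupport ψ
  support : tsupport ψ ⊆ Ω

/-- `m ∈ BV(Ω, ℝ²)`: `m` is integrable on `Ω`, and its two distributional partial derivatives
are finite (vector) measures on `Ω`, i.e. their total variations are finite. -/
structure IsBV (Ω : Set ℂ) (m : ℂ → ℂ) : Prop where
  integrable : IntegrableOn m Ω
  variation : ∃ C : ℝ, ∀ ψ : ℂ → ℝ, IsTest Ω ψ → (∀ x, |ψ x| ≤ 1) →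
    ‖∫ x in Ω, (fderiv ℝ ψ x 1) • m x‖ ≤ C ∧ ‖∫ x in Ω, (fderiv ℝ ψ x Complex.I) • m x‖ ≤ C

/-- `∇ · m = 0` in the sense of distributions on `Ω`
(`fderiv ℝ ψ x (m x)` is `m(x) · ∇ψ(x)`). -/
def IsDivFree (Ω : Set ℂ) (m : ℂ → ℂ) : Prop :=
  ∀ ψ : ℂ → ℝ, IsTest Ω ψ → ∫ x in Ω, fderiv ℝ ψ x (m x) = 0

/-- The set `A(Ω)`: fields of bounded variation with `|m| = 1` a.e. and `∇ · m = 0` on `Ω`. -/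
def fieldSet (Ω : Set ℂ) : Set (ℂ → ℂ) :=
  {m | IsBV Ω m ∧ (∀ᵐ x ∂(volume.restrict Ω), ‖m x‖ = 1) ∧ IsDivFree Ω m}

/-- `a` is the trace of `m` at the boundary point `x` of `Ω`. -/
def IsBoundaryTrace (Ω : Set ℂ) (m : ℂ → ℂ) (x a : ℂ) : Prop :=
  Tendsto (fun r : ℝ => ⨍ y in Ω ∩ Metric.ball x r, ‖m y - a‖) (𝓝[>] 0) (𝓝 0)

/-- `n` is the exterior unit normal of `Ω` at the boundary point `x`: to first order at `x`,
`Ω` is the half-plane of the `y` with `(y - x) · n < 0`. In a Lipschitz domain it exists at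
almost every boundary point, and there is at most one such `n`. -/
def IsOuterNormal (Ω : Set ℂ) (x n : ℂ) : Prop :=
  ‖n‖ = 1 ∧ ∀ ε : ℝ, 0 < ε → ∀ᶠ y in 𝓝 x,
    (y ∈ Ω → inner ℝ (y - x) n ≤ ε * ‖y - x‖) ∧
    (y ∉ Ω → -(ε * ‖y - x‖) ≤ inner ℝ (y - x) n)

/-- The set `A₀(Ω)`: the `m ∈ A(Ω)` with `m · n = 0` a.e. on `∂Ω`. -/
def tangentFieldSet (Ω : Set ℂ) : Set (ℂ → ℂ) :=
  {m | m ∈ fieldSet Ω ∧ ∀ᵐ x ∂((μH[1] : Measure ℂ).restrict (frontier Ω)),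
    ∃ a n : ℂ, IsBoundaryTrace Ω m x a ∧ IsOuterNormal Ω x n ∧ inner ℝ a n = 0}

/-- `m` has at `x` an approximate jump: it has the distinct traces `a` and `b` on the two sides
of the line through `x` with unit normal `ν`. -/
structure HasJump (m : ℂ → ℂ) (x a b ν : ℂ) : Prop where
  norm_normal : ‖ν‖ = 1
  ne : a ≠ b
  plus : Tendsto (fun r : ℝ => ⨍ y in Metric.ball x r ∩ {y | 0 < inner ℝ (y - x) ν}, ‖m y - a‖)
    (𝓝[>] 0) (𝓝 0)
  minus : Tendsto (fun r : ℝ => ⨍ y in Metric.ball x r ∩ {y | inner ℝ (y - x) ν < 0}, ‖m y - b‖)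
    (𝓝[>] 0) (𝓝 0)

/-- The jump line `J(m)` of `m` in `Ω`. -/
def jumpSet (Ω : Set ℂ) (m : ℂ → ℂ) : Set ℂ :=
  {x | x ∈ Ω ∧ ∃ a b ν : ℂ, HasJump m x a b ν}

open Classical in
/-- The jump size `|m₊ - m₋|` at a jump point `x`. At a point near which `m` is integrable,
`(a, b, ν)` is unique up to changing it into `(b, a, -ν)`, so the choice does not matter. -/
def jumpSize (m : ℂ → ℂ) (x : ℂ) : ℝ :=
  if h : ∃ t : ℝ, ∃ a b ν : ℂ, HasJump m x a b ν ∧ t = ‖a - b‖ then h.choose else 0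

/-- The line energy `I_f(m)`, the integral of `f(|m₊ - m₋|)` over `J(m)` for the length. -/
def lineEnergy (f : ℝ → ENNReal) (Ω : Set ℂ) (m : ℂ → ℂ) : ENNReal :=
  ∫⁻ x in jumpSet Ω m, f (jumpSize m x) ∂(μH[1] : Measure ℂ)

/-- `m` minimizes `I_f` over `A₀(Ω)`. -/
def IsMinimizer (f : ℝ → ENNReal) (Ω : Set ℂ) (m : ℂ → ℂ) : Prop :=
  m ∈ tangentFieldSet Ω ∧ ∀ m' ∈ tangentFieldSet Ω, lineEnergy f Ω m ≤ lineEnergy f Ω m'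

/-- The viscosity solution `(∇φ₀)^⊥`, where `φ₀` is the distance to `∂Ω`. -/
def viscositySolution (Ω : Set ℂ) : ℂ → ℂ :=
  fun x => Complex.I * gradient (fun y : ℂ => Metric.infDist y (frontier Ω)) x

/-- The cost `f(t) = t ^ p`. -/
def powerCost (p : ℝ) : ℝ → ENNReal :=
  fun t => ENNReal.ofReal t ^ p

/-- The tangent to the unit circle at its point `a`. -/
def tangentLine (a : ℂ) : Set ℂ :=
  {z | inner ℝ (z - a) a = 0}

/-- The point `B`, at distance `1 / cos θ` from the origin on the positive real axis. -/
def apex (θ : ℝ) : ℂ :=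
  ((1 / Real.cos θ : ℝ) : ℂ)

/-- `B` is the intersection of the tangents at `A = e^{iθ}` and `A' = e^{-iθ}`. -/
theorem tangentLine_inter (θ : ℝ) (hs : Real.sin θ ≠ 0) (hc : Real.cos θ ≠ 0) :
    tangentLine (Complex.exp (θ * Complex.I)) ∩ tangentLine (Complex.exp (-(θ * Complex.I)))
      = {apex θ} := by
  have e1 : Complex.exp (θ * Complex.I) = ⟨Real.cos θ, Real.sin θ⟩ := by
    apply Complex.ext <;> simp [Complex.exp_ofReal_mul_I_re, Complex.exp_ofReal_mul_I_im]
  have e2 : Complex.exp (-(θ * Complex.I)) = ⟨Real.cos θ, -Real.sin θ⟩ := by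
    have : -((θ : ℂ) * Complex.I) = ((-θ : ℝ) : ℂ) * Complex.I := by push_cast; ring
    rw [this]
    apply Complex.ext
    · rw [Complex.exp_ofReal_mul_I_re]; simp
    · rw [Complex.exp_ofReal_mul_I_im]; simp
  have hsq := Real.sin_sq_add_cos_sq θ
  rw [e1, e2]
  ext z
  simp only [tangentLine, mem_inter_iff, mem_setOf_eq, mem_singleton_iff, Complex.inner,
    Complex.mul_re, Complex.conj_re, Complex.conj_im, Complex.sub_re, Complex.sub_im]
  constructor
  · rintro ⟨h1, h2⟩
    have hi : z.im = 0 := by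
      have : z.im * Real.sin θ = 0 := by linarith
      exact (mul_eq_zero.mp this).resolve_right hs
    have hr : z.re = 1 / Real.cos θ := by
      rw [eq_div_iff hc]; nlinarith
    apply Complex.ext <;> simp [apex, -one_div, hi, hr, -Complex.ofReal_div]
  · rintro rfl
    have hm : 1 / Real.cos θ * Real.cos θ = 1 := by field_simp
    simp only [apex, Complex.ofReal_re, Complex.ofReal_im]
    constructor <;> nlinarith

/-- The convex domain `Ω_θ`: the interior of the convex hull of the unit circle and `B`. -/
def dropDomain (θ : ℝ) : Set ℂ :=
  interior (convexHull ℝ (Metric.sphere (0 : ℂ) 1 ∪ {apex θ}))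

end LineEnergy

end

/-! Write `c = cos θ`, `σ = |sin θ|`, and let `h` be the support function of the arc `{|a| = 1, re a
≤ c}`. The drop is `{h < 1}`, its distance function is `1 - h`, and the viscosity solution is `-i∇h`
almost everywhere. It jumps by `2σ` across the whole segment from `0` to `B`, so its energy is at
least `(2σ)^p / c`.

The competitor is the rotated gradient of `max (1 - |x|) (h - 1)`. It is a vortex around `0`, which
removes the jump on the axis from `0` to `2/(1+c)`. The price is a ridge `h + |x| = 2`, made of two
parabolic arcs of total length at most `16σ`, on which the jump lies in `[1, 2]`. The saving is at
least `(2σ)^p` and the price is at most `2^|p| * 16σ`. As `p < 1`, the saving wins for small `σ`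
(`lineEnergy_competitor_lt`).

Both fields are admissible because gradients of convex Lipschitz functions are BV and their
rotations are divergence free (`IsSubgradientField.isBV`, `IsSubgradientField.isDivFree`). The
competitor comes from a difference of two such functions (`competitor_eq`). Only a lower bound is
needed for the first energy (`le_lineEnergy_viscositySolution`) and only an upper bound for the
second (`lineEnergy_competitor_le`). -/

namespace LineEnergy

open scoped NNReal

/-! ### Gradients of convex Lipschitz functions are BV, and their rotations are divergence free. -/

/-- `U` is a measurable selection of subgradients of the convex function `u`, bounded by `C`. -/
structure IsSubgradientField (C : ℝ≥0) (u : ℂ → ℝ) (U : ℂ → ℂ) : Prop where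
  measurable : Measurable U
  norm_le : ∀ x, ‖U x‖ ≤ C
  le : ∀ x y, u x + inner ℝ (U x) (y - x) ≤ u y

/-- The pairing `∫ ∂_v ψ (U · w)`. -/
noncomputable def gradPairing (ψ : ℂ → ℝ) (U : ℂ → ℂ) (v w : ℂ) : ℝ :=
  ∫ x, fderiv ℝ ψ x v * inner ℝ (U x) w

theorem measurable_inner_const {U : ℂ → ℂ} (hU : Measurable U) (w : ℂ) :
    Measurable fun x => inner ℝ (U x) w :=
  hU.inner measurable_const

theorem integrable_mul_inner {f : ℂ → ℝ} (hf : Continuous f) (hc : HasCompactSupport f)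
    {U : ℂ → ℂ} (hU : Measurable U) {C : ℝ} (hC : ∀ x, ‖U x‖ ≤ C) (w : ℂ) :
    Integrable fun x => f x * inner ℝ (U x) w := by
  refine (hf.integrable_of_hasCompactSupport hc).mul_bdd (c := C * ‖w‖)
    (measurable_inner_const hU w).aestronglyMeasurable (Eventually.of_forall fun x => ?_)
  exact (norm_inner_le_norm _ _).trans (by gcongr; exact hC x)

theorem continuous_fderiv_apply_const {ψ : ℂ → ℝ} (hψ : ContDiff ℝ (⊤ : ℕ∞) ψ) (v : ℂ) :
    Continuous fun x => fderiv ℝ ψ x v :=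
  (hψ.continuous_fderiv (by simp)).clm_apply continuous_const

theorem hasCompactSupport_fderiv_apply_const {ψ : ℂ → ℝ} (hc : HasCompactSupport ψ) (v : ℂ) :
    HasCompactSupport fun x => fderiv ℝ ψ x v :=
  hc.fderiv_apply (𝕜 := ℝ) v

theorem integrable_gradPairing {ψ : ℂ → ℝ} (hψ : ContDiff ℝ (⊤ : ℕ∞) ψ)
    (hc : HasCompactSupport ψ) {U : ℂ → ℂ} (hU : Measurable U) {C : ℝ} (hC : ∀ x, ‖U x‖ ≤ C)
    (v w : ℂ) : Integrable fun x => fderiv ℝ ψ x v * inner ℝ (U x) w :=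
  integrable_mul_inner (continuous_fderiv_apply_const hψ v)
    (hasCompactSupport_fderiv_apply_const hc v) hU hC w

namespace IsSubgradientField

variable {C : ℝ≥0} {u : ℂ → ℝ} {U : ℂ → ℂ}

theorem lipschitzWith (h : IsSubgradientField C u U) : LipschitzWith C u := by
  refine LipschitzWith.of_le_add_mul C fun x y => ?_
  have h1 := h.le x y
  have h2 : |inner ℝ (U x) (y - x)| ≤ C * dist x y := by
    refine (abs_real_inner_le_norm _ _).trans ?_
    rw [dist_comm, dist_eq_norm]
    gcongr
    exact h.norm_le x
  have h3 := neg_abs_le (inner ℝ (U x) (y - x))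
  linarith

/-- At a point of differentiability the only subgradient is the gradient. -/
theorem fderiv_apply (h : IsSubgradientField C u U) {x : ℂ} (hx : DifferentiableAt ℝ u x) (v : ℂ) :
    fderiv ℝ u x v = inner ℝ (U x) v := by
  have hd : DifferentiableAt ℝ (fun y => (innerSL ℝ (U x)) y) x :=
    (innerSL ℝ (U x)).differentiableAt
  have hmin : IsLocalMin (fun y => u y - (innerSL ℝ (U x)) y) x := by
    refine Eventually.of_forall fun y => ?_
    have := h.le x y
    simp only [inner_sub_right, innerSL_apply_apply] at this ⊢
    linarith
  have h0 := hmin.fderiv_eq_zero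
  rw [fderiv_fun_sub hx hd, ContinuousLinearMap.fderiv] at h0
  have := congrArg (fun L : ℂ →L[ℝ] ℝ => L v) h0
  simp only [sub_apply, innerSL_apply_apply,
    zero_apply] at this
  linarith

theorem ae_lineDeriv (h : IsSubgradientField C u U) :
    ∀ᵐ x, ∀ v, lineDeriv ℝ u x v = inner ℝ (U x) v := by
  filter_upwards [h.lipschitzWith.ae_differentiableAt (μ := volume)] with x hx v
  rw [hx.lineDeriv_eq_fderiv, h.fderiv_apply hx]

/-- By Rademacher `U` is almost everywhere the gradient of `u`, and a Lipschitz function may be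
integrated by parts. All derivatives then fall on the smooth `ψ`, whose second derivative is
symmetric; hence `gradPairing_comm`. -/
theorem gradPairing_eq (h : IsSubgradientField C u U) {ψ : ℂ → ℝ}
    (hψ : ContDiff ℝ (⊤ : ℕ∞) ψ) (hc : HasCompactSupport ψ) (v w : ℂ) :
    gradPairing ψ U v w = -∫ x, fderiv ℝ (fderiv ℝ ψ) x w v * u x := by
  have hsm : ContDiff ℝ (⊤ : ℕ∞) fun x => fderiv ℝ ψ x v :=
    (hψ.fderiv_right (by simp)).clm_apply contDiff_const
  obtain ⟨D, hD⟩ := hsm.lipschitzWith_of_hasCompactSupport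
    (hasCompactSupport_fderiv_apply_const hc v) (by simp)
  have key := h.lipschitzWith.integral_lineDeriv_mul_eq (μ := volume) hD
    (hasCompactSupport_fderiv_apply_const hc v) w
  have e1 : gradPairing ψ U v w = ∫ x, lineDeriv ℝ u x w * fderiv ℝ ψ x v := by
    refine integral_congr_ae ?_
    filter_upwards [h.ae_lineDeriv] with x hx
    rw [hx w, mul_comm]
  rw [e1, key, ← integral_neg]
  congr 1
  ext x
  have hd2 : DifferentiableAt ℝ (fderiv ℝ ψ) x :=
    ((hψ.fderiv_right (m := (⊤ : ℕ∞)) (by simp)).differentiable (by simp)) x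
  rw [((hsm.differentiable (by simp)) x).lineDeriv_eq_fderiv,
    fderiv_clm_apply hd2 (differentiableAt_const v)]
  simp

theorem gradPairing_comm (h : IsSubgradientField C u U) {ψ : ℂ → ℝ}
    (hψ : ContDiff ℝ (⊤ : ℕ∞) ψ) (hc : HasCompactSupport ψ) (v w : ℂ) :
    gradPairing ψ U v w = gradPairing ψ U w v := by
  rw [h.gradPairing_eq hψ hc, h.gradPairing_eq hψ hc]
  congr 2
  ext x
  have : IsSymmSndFDerivAt ℝ ψ x :=
    hψ.contDiffAt.isSymmSndFDerivAt (by
      rw [minSmoothness_of_isRCLikeNormedField]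
      exact WithTop.coe_le_coe.2 (le_top (a := (2 : ℕ∞))))
  rw [this.eq v w]

/-- The pure second derivatives of a convex function are nonnegative. -/
theorem gradPairing_self_nonpos (h : IsSubgradientField C u U) {ψ : ℂ → ℝ}
    (hψ : ContDiff ℝ (⊤ : ℕ∞) ψ) (hc : HasCompactSupport ψ) (h0 : ∀ x, 0 ≤ ψ x) (v : ℂ) :
    gradPairing ψ U v v ≤ 0 := by
  obtain ⟨D, hD⟩ := hψ.lipschitzWith_of_hasCompactSupport hc (by simp)
  obtain ⟨R, hR⟩ := hc.isCompact.isBounded.subset_closedBall (0 : ℂ)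
  have hz : ∀ x, R < ‖x‖ → ψ x = 0 := fun x hx => by
    refine image_eq_zero_of_notMem_tsupport fun hx' => ?_
    have := hR hx'
    rw [mem_closedBall_zero_iff] at this
    linarith
  set k : ℂ → ℝ := fun x => inner ℝ (U x) v with hk
  -- The convergence of difference quotients needs an integrable weight, so `U · v` is cut off to a
  -- ball that contains the supports of all translates of `ψ` by `t • v` with `0 < t ≤ 1`.
  set B := Metric.closedBall (0 : ℂ) (R + ‖v‖)
  have hkm : Measurable k := measurable_inner_const h.measurable v
  have hkb : ∀ x, ‖k x‖ ≤ C * ‖v‖ := fun x =>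
    (norm_inner_le_norm _ _).trans (by gcongr; exact h.norm_le x)
  have hg : Integrable (B.indicator k) := by
    rw [integrable_indicator_iff Metric.isClosed_closedBall.measurableSet]
    exact Measure.integrableOn_of_bounded
      (isCompact_closedBall (0 : ℂ) (R + ‖v‖)).measure_lt_top.ne
      hkm.aestronglyMeasurable (Eventually.of_forall hkb)
  have hout : ∀ x, x ∉ B → R + ‖v‖ < ‖x‖ := fun x hx => by
    simpa [B] using hx
  have lim := hD.integral_inv_smul_sub_mul_tendsto_integral_lineDeriv_mul hg v
  have elim : ∫ x, lineDeriv ℝ ψ x v * B.indicator k x = gradPairing ψ U v v := by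
    refine integral_congr_ae (Eventually.of_forall fun x => ?_)
    simp only
    rw [((hψ.differentiable (by simp)) x).lineDeriv_eq_fderiv]
    by_cases hx : x ∈ B
    · rw [indicator_of_mem hx]
    · have : x ∉ tsupport ψ := fun hx' => by
        have h1 := hR hx'
        rw [mem_closedBall_zero_iff] at h1
        linarith [hout x hx, norm_nonneg v]
      simp [fderiv_of_notMem_tsupport ℝ this]
  rw [elim] at lim
  refine le_of_tendsto lim ?_
  filter_upwards [Ioc_mem_nhdsGT (zero_lt_one' ℝ)] with t ht
  have hint : ∀ s : ℂ, Integrable fun x => ψ (x + s) * k x := fun s =>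
    integrable_mul_inner (hψ.continuous.comp (continuous_add_const s))
      (hc.comp_homeomorph (Homeomorph.addRight s)) h.measurable h.norm_le v
  have e2 : ∀ x, t⁻¹ • (ψ (x + t • v) - ψ x) * B.indicator k x
      = t⁻¹ * (ψ (x + t • v) * k x - ψ (x + 0) * k x) := fun x => by
    by_cases hx : x ∈ B
    · rw [indicator_of_mem hx, smul_eq_mul, add_zero]; ring
    · have h1 := hout x hx
      have h2 : ‖x‖ - ‖t • v‖ ≤ ‖x + t • v‖ := by
        have := norm_sub_norm_le x (-(t • v))
        rwa [norm_neg, sub_neg_eq_add] at this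
      have h3 : ‖t • v‖ ≤ ‖v‖ := by
        rw [norm_smul, Real.norm_of_nonneg ht.1.le]
        exact mul_le_of_le_one_left (norm_nonneg v) ht.2
      rw [add_zero, hz x (by linarith [norm_nonneg v]), hz _ (by linarith)]
      simp
  simp_rw [e2]
  rw [integral_const_mul, integral_sub (hint _) (hint 0)]
  -- Discrete integration by parts: the translation passes from `ψ` to `k`, whose increments have a
  -- sign because subgradients are monotone.
  have e3 : ∫ x, ψ (x + t • v) * k x = ∫ x, ψ x * k (x - t • v) := by
    rw [← integral_sub_right_eq_self (fun x => ψ (x + t • v) * k x) (t • v)]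
    simp
  have hint' : Integrable fun x => ψ x * k (x - t • v) :=
    integrable_mul_inner (U := fun x => U (x - t • v)) hψ.continuous hc
      (h.measurable.comp (measurable_id.sub_const _)) (fun x => h.norm_le _) v
  simp only [add_zero]
  rw [e3, ← integral_sub hint' (by simpa using hint 0)]
  refine mul_nonpos_of_nonneg_of_nonpos (inv_nonneg.2 ht.1.le) (integral_nonpos fun x => ?_)
  have h1 := h.le x (x - t • v)
  have h2 := h.le (x - t • v) x
  rw [sub_sub_cancel_left, inner_neg_right, real_inner_smul_right] at h1
  rw [sub_sub_cancel, real_inner_smul_right] at h2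
  have h3 : k (x - t • v) ≤ k x := by
    have : t * k (x - t • v) ≤ t * k x := by simp only [hk]; linarith
    exact le_of_mul_le_mul_left this ht.1
  show ψ x * k (x - t • v) - ψ x * k x ≤ 0
  have := mul_le_mul_of_nonneg_left h3 (h0 x)
  linarith

end IsSubgradientField

theorem gradPairing_add {ψ χ : ℂ → ℝ} (hψ : ContDiff ℝ (⊤ : ℕ∞) ψ) (hc : HasCompactSupport ψ)
    (hχ : ContDiff ℝ (⊤ : ℕ∞) χ) (hc' : HasCompactSupport χ)
    {U : ℂ → ℂ} (hU : Measurable U) {C : ℝ} (hC : ∀ x, ‖U x‖ ≤ C) (v w : ℂ) :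
    gradPairing (fun x => χ x + ψ x) U v w = gradPairing χ U v w + gradPairing ψ U v w := by
  unfold gradPairing
  rw [← integral_add (integrable_gradPairing hχ hc' hU hC v w)
    (integrable_gradPairing hψ hc hU hC v w)]
  congr 1
  ext x
  rw [fderiv_fun_add (hχ.differentiable (by simp) x) (hψ.differentiable (by simp) x)]
  simp [add_mul]

theorem gradPairing_neg (ψ : ℂ → ℝ) (U : ℂ → ℂ) (v w : ℂ) :
    gradPairing (fun x => -ψ x) U v w = -gradPairing ψ U v w := by
  unfold gradPairing
  rw [← integral_neg]
  congr 1
  ext x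
  rw [fderiv_fun_neg]
  simp

theorem gradPairing_add_add {ψ : ℂ → ℝ} (hψ : ContDiff ℝ (⊤ : ℕ∞) ψ) (hc : HasCompactSupport ψ)
    {U : ℂ → ℂ} (hU : Measurable U) {C : ℝ} (hC : ∀ x, ‖U x‖ ≤ C) (v w : ℂ) :
    gradPairing ψ U (v + w) (v + w) = gradPairing ψ U v v + gradPairing ψ U w w
      + (gradPairing ψ U v w + gradPairing ψ U w v) := by
  have hi := integrable_gradPairing hψ hc hU hC
  unfold gradPairing
  rw [← integral_add (hi v v) (hi w w), ← integral_add (hi v w) (hi w v)]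
  refine Eq.trans (integral_congr_ae (Eventually.of_forall fun x => ?_))
    (integral_add ((hi v v).add (hi w w)) ((hi v w).add (hi w v)))
  simp only [map_add, inner_add_right]
  ring

theorem setIntegral_eq_of_isTest {Ω : Set ℂ} {ψ : ℂ → ℝ} (hψ : IsTest Ω ψ) {E : Type*}
    [NormedAddCommGroup E] [NormedSpace ℝ E] (F : ℂ → (ℂ →L[ℝ] ℝ) → E) (hF : ∀ x, F x 0 = 0) :
    ∫ x in Ω, F x (fderiv ℝ ψ x) = ∫ x, F x (fderiv ℝ ψ x) := by
  refine setIntegral_eq_integral_of_forall_compl_eq_zero fun x hx => ?_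
  rw [fderiv_of_notMem_tsupport ℝ fun h => hx (hψ.support h), hF]

theorem exists_cutoff {Ω : Set ℂ} (hΩ : Bornology.IsBounded Ω) :
    ∃ χ : ℂ → ℝ, ContDiff ℝ (⊤ : ℕ∞) χ ∧ HasCompactSupport χ ∧ (∀ x, 0 ≤ χ x) ∧
      ∀ x ∈ Ω, χ x = 1 := by
  obtain ⟨R, hR0, hR⟩ := hΩ.subset_closedBall_lt 0 (0 : ℂ)
  let f : ContDiffBump (0 : ℂ) := ⟨R, R + 1, hR0, by linarith⟩
  exact ⟨f, f.contDiff, f.hasCompactSupport, fun x => f.nonneg,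
    fun x hx => f.one_of_mem_closedBall (hR hx)⟩

/-- A nonnegative distribution is a measure: with a cutoff `χ` equal to `1` on `Ω`, both `χ + ψ` and
`χ - ψ` are nonnegative, so the pairing with `χ` bounds the one with `ψ`. -/
theorem IsSubgradientField.exists_gradPairing_self_le {C : ℝ≥0} {u : ℂ → ℝ} {U : ℂ → ℂ}
    (h : IsSubgradientField C u U) {Ω : Set ℂ} (hΩ : Bornology.IsBounded Ω) (v : ℂ) :
    ∃ K : ℝ, ∀ ψ : ℂ → ℝ, IsTest Ω ψ → (∀ x, |ψ x| ≤ 1) → |gradPairing ψ U v v| ≤ K := by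
  obtain ⟨χ, hχ, hχc, hχ0, hχ1⟩ := exists_cutoff hΩ
  refine ⟨-gradPairing χ U v v, fun ψ hψ hψ1 => ?_⟩
  have hb : ∀ x, |ψ x| ≤ χ x := fun x => by
    by_cases hx : x ∈ Ω
    · rw [hχ1 x hx]; exact hψ1 x
    · rw [image_eq_zero_of_notMem_tsupport fun h => hx (hψ.support h), abs_zero]
      exact hχ0 x
  have h1 := h.gradPairing_self_nonpos (hχ.add hψ.smooth) (hχc.add hψ.compact)
    (fun x => by have := neg_abs_le (ψ x); have := hb x; linarith) v
  have h2 := h.gradPairing_self_nonpos (hχ.add hψ.smooth.neg) (hχc.add hψ.compact.neg)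
    (fun x => by
      have := le_abs_self (ψ x); have := hb x
      linarith) v
  have e1 := gradPairing_add hψ.smooth hψ.compact hχ hχc h.measurable h.norm_le v v
  have e2 := gradPairing_add hψ.smooth.neg hψ.compact.neg hχ hχc h.measurable h.norm_le v v
  have e3 := gradPairing_neg ψ U v v
  change gradPairing (fun x => χ x + ψ x) U v v ≤ 0 at h1
  change gradPairing (fun x => χ x + -ψ x) U v v ≤ 0 at h2
  change gradPairing (fun x => χ x + -ψ x) U v v = gradPairing χ U v v
    + gradPairing (fun x => -ψ x) U v v at e2
  rw [abs_le]
  constructor <;> linarith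

/-- Polarization: mixed second derivatives are combinations of pure ones in the directions `v`, `w`
and `v + w`. -/
theorem IsSubgradientField.exists_gradPairing_le {C : ℝ≥0} {u : ℂ → ℝ} {U : ℂ → ℂ}
    (h : IsSubgradientField C u U) {Ω : Set ℂ} (hΩ : Bornology.IsBounded Ω) (v w : ℂ) :
    ∃ K : ℝ, ∀ ψ : ℂ → ℝ, IsTest Ω ψ → (∀ x, |ψ x| ≤ 1) → |gradPairing ψ U v w| ≤ K := by
  obtain ⟨K₁, h₁⟩ := h.exists_gradPairing_self_le hΩ v
  obtain ⟨K₂, h₂⟩ := h.exists_gradPairing_self_le hΩ w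
  obtain ⟨K₃, h₃⟩ := h.exists_gradPairing_self_le hΩ (v + w)
  refine ⟨K₁ + K₂ + K₃, fun ψ hψ hψ1 => ?_⟩
  have e := gradPairing_add_add hψ.smooth hψ.compact h.measurable h.norm_le v w
  rw [h.gradPairing_comm hψ.smooth hψ.compact w v] at e
  have a1 := abs_le.1 (h₁ ψ hψ hψ1)
  have a2 := abs_le.1 (h₂ ψ hψ hψ1)
  have a3 := abs_le.1 (h₃ ψ hψ hψ1)
  rw [abs_le]
  constructor <;> linarith

theorem norm_integral_fderiv_smul_le {Ω : Set ℂ} {ψ : ℂ → ℝ} (hψ : IsTest Ω ψ) {U : ℂ → ℂ}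
    (hU : Measurable U) {C : ℝ} (hC : ∀ x, ‖U x‖ ≤ C) (v : ℂ) :
    ‖∫ x in Ω, fderiv ℝ ψ x v • U x‖
      ≤ |gradPairing ψ U v 1| + |gradPairing ψ U v Complex.I| := by
  rw [setIntegral_eq_of_isTest hψ (fun x L => L v • U x) (by simp)]
  have hi : Integrable fun x => fderiv ℝ ψ x v • U x :=
    (continuous_fderiv_apply_const hψ.smooth v).integrable_of_hasCompactSupport
      (hasCompactSupport_fderiv_apply_const hψ.compact v) |>.smul_bdd C
      hU.aestronglyMeasurable (Eventually.of_forall hC)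
  refine (Complex.norm_le_abs_re_add_abs_im _).trans (le_of_eq ?_)
  congr 2
  · have := Complex.reCLM.integral_comp_comm hi
    simp only [Complex.reCLM_apply] at this
    rw [← this]
    unfold gradPairing
    congr 1; ext x
    simp [Complex.inner]
  · have := Complex.imCLM.integral_comp_comm hi
    simp only [Complex.imCLM_apply] at this
    rw [← this]
    unfold gradPairing
    congr 1; ext x
    simp [Complex.inner]

theorem IsSubgradientField.isBV {C : ℝ≥0} {u : ℂ → ℝ} {U : ℂ → ℂ}
    (h : IsSubgradientField C u U) {Ω : Set ℂ} (hΩ : Bornology.IsBounded Ω) :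
    IsBV Ω U := by
  refine ⟨Measure.integrableOn_of_bounded hΩ.measure_lt_top.ne
    h.measurable.aestronglyMeasurable (Eventually.of_forall h.norm_le), ?_⟩
  obtain ⟨K₁, h₁⟩ := h.exists_gradPairing_le hΩ 1 1
  obtain ⟨K₂, h₂⟩ := h.exists_gradPairing_le hΩ 1 Complex.I
  obtain ⟨K₃, h₃⟩ := h.exists_gradPairing_le hΩ Complex.I Complex.I
  refine ⟨max (K₁ + K₂) (K₂ + K₃), fun ψ hψ hψ1 => ⟨?_, ?_⟩⟩
  · exact (norm_integral_fderiv_smul_le hψ h.measurable h.norm_le 1).trans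
      (le_max_of_le_left (add_le_add (h₁ ψ hψ hψ1) (h₂ ψ hψ hψ1)))
  · refine (norm_integral_fderiv_smul_le hψ h.measurable h.norm_le Complex.I).trans
      (le_max_of_le_right (add_le_add ?_ (h₃ ψ hψ hψ1)))
    rw [h.gradPairing_comm hψ.smooth hψ.compact]
    exact h₂ ψ hψ hψ1

theorem IsBV.I_mul {Ω : Set ℂ} {m : ℂ → ℂ} (h : IsBV Ω m) :
    IsBV Ω fun x => Complex.I * m x := by
  refine ⟨h.integrable.const_mul _, ?_⟩
  obtain ⟨K, hK⟩ := h.variation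
  refine ⟨K, fun ψ hψ hψ1 => ?_⟩
  have e : ∀ v, ∫ x in Ω, fderiv ℝ ψ x v • (Complex.I * m x)
      = Complex.I * ∫ x in Ω, fderiv ℝ ψ x v • m x := fun v => by
    rw [← integral_const_mul]
    congr 1; ext1 x
    exact mul_smul_comm _ _ _ |>.symm
  rw [e, e, norm_mul, norm_mul, Complex.norm_I, one_mul, one_mul]
  exact hK ψ hψ hψ1

theorem IsBV.neg {Ω : Set ℂ} {m : ℂ → ℂ} (h : IsBV Ω m) : IsBV Ω fun x => -m x := by
  refine ⟨h.integrable.neg, ?_⟩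
  obtain ⟨K, hK⟩ := h.variation
  refine ⟨K, fun ψ hψ hψ1 => ?_⟩
  simpa only [smul_neg, integral_neg, norm_neg] using hK ψ hψ hψ1

theorem IsTest.integrableOn_smul {Ω : Set ℂ} {ψ : ℂ → ℝ} (hψ : IsTest Ω ψ) {m : ℂ → ℂ}
    (hm : IntegrableOn m Ω) (v : ℂ) : IntegrableOn (fun x => fderiv ℝ ψ x v • m x) Ω := by
  have hc := continuous_fderiv_apply_const hψ.smooth v
  obtain ⟨K, hK⟩ := (hasCompactSupport_fderiv_apply_const hψ.compact v).exists_bound_of_continuous hc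
  exact Integrable.bdd_smul hm K hc.aestronglyMeasurable (Eventually.of_forall hK)

theorem IsBV.add {Ω : Set ℂ} {m m' : ℂ → ℂ} (h : IsBV Ω m) (h' : IsBV Ω m') :
    IsBV Ω fun x => m x + m' x := by
  refine ⟨h.integrable.add h'.integrable, ?_⟩
  obtain ⟨K, hK⟩ := h.variation
  obtain ⟨K', hK'⟩ := h'.variation
  refine ⟨K + K', fun ψ hψ hψ1 => ?_⟩
  simp only [smul_add]
  rw [integral_add (hψ.integrableOn_smul h.integrable _) (hψ.integrableOn_smul h'.integrable _),
    integral_add (hψ.integrableOn_smul h.integrable _) (hψ.integrableOn_smul h'.integrable _)]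
  exact ⟨(norm_add_le _ _).trans (add_le_add (hK ψ hψ hψ1).1 (hK' ψ hψ hψ1).1),
    (norm_add_le _ _).trans (add_le_add (hK ψ hψ hψ1).2 (hK' ψ hψ hψ1).2)⟩

theorem IsDivFree.neg {Ω : Set ℂ} {m : ℂ → ℂ} (h : IsDivFree Ω m) :
    IsDivFree Ω fun x => -m x := fun ψ hψ => by
  simpa only [map_neg, integral_neg, neg_eq_zero] using h ψ hψ

theorem fderiv_apply_eq_re_im (L : ℂ →L[ℝ] ℝ) (z : ℂ) :
    L z = L 1 * z.re + L Complex.I * z.im := by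
  conv_lhs => rw [← Complex.re_add_im z]
  have e1 : (z.re : ℂ) = z.re • (1 : ℂ) := by simp
  have e2 : (z.im : ℂ) * Complex.I = z.im • Complex.I := by simp
  rw [map_add, e1, e2, map_smul, map_smul, smul_eq_mul, smul_eq_mul]
  ring

theorem IsTest.integrableOn_fderiv {Ω : Set ℂ} {ψ : ℂ → ℝ} (hψ : IsTest Ω ψ) {m : ℂ → ℂ}
    (hm : IntegrableOn m Ω) : IntegrableOn (fun x => fderiv ℝ ψ x (m x)) Ω := by
  have h1 := (hψ.integrableOn_smul hm 1).re
  have h2 := (hψ.integrableOn_smul hm Complex.I).im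
  refine (h1.add h2).congr (Eventually.of_forall fun x => ?_)
  simp [fderiv_apply_eq_re_im (fderiv ℝ ψ x) (m x)]

theorem IsDivFree.add {Ω : Set ℂ} {m m' : ℂ → ℂ} (h : IsDivFree Ω m) (h' : IsDivFree Ω m')
    (hm : IntegrableOn m Ω) (hm' : IntegrableOn m' Ω) :
    IsDivFree Ω fun x => m x + m' x := fun ψ hψ => by
  simp only [map_add]
  rw [integral_add (hψ.integrableOn_fderiv hm) (hψ.integrableOn_fderiv hm'), h ψ hψ, h' ψ hψ,
    add_zero]

/-- Rotated gradients are divergence free. -/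
theorem IsSubgradientField.isDivFree {C : ℝ≥0} {u : ℂ → ℝ} {U : ℂ → ℂ}
    (h : IsSubgradientField C u U) (Ω : Set ℂ) : IsDivFree Ω fun x => Complex.I * U x := by
  intro ψ hψ
  rw [setIntegral_eq_of_isTest hψ (fun x L => L (Complex.I * U x)) (by simp)]
  have hi := integrable_gradPairing hψ.smooth hψ.compact h.measurable h.norm_le
  -- Symmetry of the two mixed derivatives is the vanishing of the curl of `U`, that is of the
  -- divergence of `I * U`.
  have e := h.gradPairing_comm hψ.smooth hψ.compact Complex.I 1
  rw [← sub_eq_zero] at e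
  unfold gradPairing at e
  rw [← integral_sub (hi _ _) (hi _ _)] at e
  rw [← e]
  congr 1; ext x
  rw [fderiv_apply_eq_re_im]
  simp [Complex.inner]
  ring

/-! ### Averaged traces, and the jump size of a field with at most two limit values at a point. -/

theorem norm_setAverage_le {s : Set ℂ} (hs : volume s ≠ ⊤) {f : ℂ → ℝ} {ε : ℝ} (hε : 0 ≤ ε)
    (hf : ∀ x ∈ s, ‖f x‖ ≤ ε) : ‖⨍ x in s, f x‖ ≤ ε := by
  rw [setAverage_eq, norm_smul, norm_inv, Real.norm_of_nonneg measureReal_nonneg]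
  have h := norm_setIntegral_le_of_norm_le_const hs.lt_top hf
  rcases (measureReal_nonneg : 0 ≤ volume.real s).eq_or_lt with h0 | h0
  · rw [← h0]; simpa using hε
  · rwa [inv_mul_le_iff₀ h0, mul_comm]

theorem tendsto_setAverage_of_tendsto {S : Set ℂ} {m : ℂ → ℂ} {x a : ℂ}
    (h : Tendsto m (𝓝[S] x) (𝓝 a)) :
    Tendsto (fun r : ℝ => ⨍ y in S ∩ Metric.ball x r, ‖m y - a‖) (𝓝[>] 0) (𝓝 0) := by
  rw [Metric.tendsto_nhds]
  intro ε hε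
  have h1 : ∀ᶠ y in 𝓝[S] x, ‖m y - a‖ < ε / 2 := by
    have := Metric.tendsto_nhds.1 h (ε / 2) (by positivity)
    simpa only [dist_eq_norm] using this
  rw [eventually_nhdsWithin_iff] at h1
  obtain ⟨δ, hδ, hδ'⟩ := Metric.eventually_nhds_iff_ball.1 h1
  filter_upwards [Ioc_mem_nhdsGT hδ] with r hr
  rw [dist_zero_right]
  refine (norm_setAverage_le (ε := ε / 2) ?_ (by positivity) fun y hy => ?_).trans_lt
    (by linarith)
  · exact (measure_mono inter_subset_right |>.trans_lt measure_ball_lt_top).ne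
  · rw [norm_norm]
    exact (hδ' y (Metric.ball_subset_ball hr.2 hy.2) hy.1).le

theorem isBoundaryTrace_of_tendsto {Ω : Set ℂ} {m : ℂ → ℂ} {x a : ℂ}
    (h : Tendsto m (𝓝[Ω] x) (𝓝 a)) : IsBoundaryTrace Ω m x a :=
  tendsto_setAverage_of_tendsto h

theorem hasJump_of_tendsto {m : ℂ → ℂ} {x a b ν : ℂ} (hν : ‖ν‖ = 1) (hab : a ≠ b)
    (ha : Tendsto m (𝓝[{y | 0 < inner ℝ (y - x) ν}] x) (𝓝 a))
    (hb : Tendsto m (𝓝[{y | inner ℝ (y - x) ν < 0}] x) (𝓝 b)) : HasJump m x a b ν := by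
  refine ⟨hν, hab, ?_, ?_⟩
  · simpa only [inter_comm] using tendsto_setAverage_of_tendsto ha
  · simpa only [inter_comm] using tendsto_setAverage_of_tendsto hb

theorem isOpen_halfBall (x ν : ℂ) (r : ℝ) :
    IsOpen (Metric.ball x r ∩ {y | 0 < inner ℝ (y - x) ν}) :=
  Metric.isOpen_ball.inter (isOpen_lt continuous_const (by fun_prop))

/-- A one-sided trace of a bounded field is one of its limit values. -/
theorem eq_or_eq_of_tendsto_setAverage {m : ℂ → ℂ} (hm : Measurable m) (hb : ∀ y, ‖m y‖ ≤ 1)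
    {x a u v ν : ℂ} (hν : ‖ν‖ = 1)
    (ht : Tendsto (fun r : ℝ => ⨍ y in Metric.ball x r ∩ {y | 0 < inner ℝ (y - x) ν}, ‖m y - a‖)
      (𝓝[>] 0) (𝓝 0))
    (huv : ∀ ε > 0, ∀ᶠ y in 𝓝 x, ‖m y - u‖ < ε ∨ ‖m y - v‖ < ε) : a = u ∨ a = v := by
  by_contra! hne
  have hu : 0 < ‖a - u‖ := norm_pos_iff.2 (sub_ne_zero.2 hne.1)
  have hv : 0 < ‖a - v‖ := norm_pos_iff.2 (sub_ne_zero.2 hne.2)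
  -- Where `m` is within `δ` of `u` or of `v`, it is at least `δ` away from `a`; the averages of `‖m
  -- - a‖` then cannot tend to `0`.
  set δ := min ‖a - u‖ ‖a - v‖ / 2 with hδ
  have hδ0 : 0 < δ := by positivity
  obtain ⟨ρ, hρ, hρ'⟩ := Metric.eventually_nhds_iff_ball.1 (huv δ hδ0)
  have hsmall := (Metric.tendsto_nhds.1 ht δ hδ0)
  obtain ⟨r, hr1, hr2⟩ := (hsmall.and (Ioc_mem_nhdsGT hρ)).exists
  rw [dist_zero_right] at hr1
  set D := Metric.ball x r ∩ {y | 0 < inner ℝ (y - x) ν} with hD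
  have hDo : IsOpen D := isOpen_halfBall x ν r
  have hDne : D.Nonempty := by
    refine ⟨x + (r / 2) • ν, ?_, ?_⟩
    · rw [mem_ball_iff_norm, add_sub_cancel_left, norm_smul, hν, mul_one,
        Real.norm_of_nonneg (by linarith [hr2.1])]
      linarith [hr2.1]
    · show 0 < inner ℝ (x + (r / 2) • ν - x) ν
      rw [add_sub_cancel_left, real_inner_smul_left, real_inner_self_eq_norm_sq, hν]
      linarith [hr2.1]
  have hD0 : volume D ≠ 0 := (hDo.measure_pos volume hDne).ne'
  have hD1 : volume D ≠ ⊤ :=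
    (measure_mono inter_subset_left |>.trans_lt measure_ball_lt_top).ne
  have hlow : ∀ y ∈ D, δ ≤ ‖m y - a‖ := fun y hy => by
    have h1 := min_le_left ‖a - u‖ ‖a - v‖
    have h2 := min_le_right ‖a - u‖ ‖a - v‖
    rcases hρ' y (Metric.ball_subset_ball hr2.2 hy.1) with h | h
    · have := norm_sub_le_norm_sub_add_norm_sub a (m y) u
      rw [norm_sub_rev a (m y)] at this
      linarith
    · have := norm_sub_le_norm_sub_add_norm_sub a (m y) v
      rw [norm_sub_rev a (m y)] at this
      linarith
  have hint : IntegrableOn (fun y => ‖m y - a‖) D := by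
    refine Measure.integrableOn_of_bounded (M := 1 + ‖a‖) hD1
      (hm.sub_const a).norm.aestronglyMeasurable (Eventually.of_forall fun y => ?_)
    rw [norm_norm]
    exact (norm_sub_le _ _).trans (by linarith [hb y])
  have hmono := setIntegral_mono_on (integrableOn_const hD1) hint hDo.measurableSet hlow
  have havg : δ ≤ ⨍ y in D, ‖m y - a‖ := by
    rw [← setAverage_const hD0 hD1 δ, setAverage_eq, setAverage_eq]
    exact smul_le_smul_of_nonneg_left hmono (inv_nonneg.2 measureReal_nonneg)
  exact absurd (havg.trans (le_abs_self _)) (not_le.2 hr1)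

theorem HasJump.eq_or_eq {m : ℂ → ℂ} (hm : Measurable m) (hb : ∀ y, ‖m y‖ ≤ 1)
    {x a b u v ν : ℂ} (h : HasJump m x a b ν)
    (huv : ∀ ε > 0, ∀ᶠ y in 𝓝 x, ‖m y - u‖ < ε ∨ ‖m y - v‖ < ε) :
    (a = u ∧ b = v) ∨ (a = v ∧ b = u) := by
  have ha := eq_or_eq_of_tendsto_setAverage hm hb h.norm_normal h.plus huv
  have h2 := h.minus
  have e : {y : ℂ | inner ℝ (y - x) ν < 0} = {y | 0 < inner ℝ (y - x) (-ν)} := by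
    ext y; simp
  rw [e] at h2
  have hb' := eq_or_eq_of_tendsto_setAverage hm hb (by rw [norm_neg]; exact h.norm_normal) h2 huv
  have := h.ne
  grind

theorem HasJump.norm_sub_eq {m : ℂ → ℂ} (hm : Measurable m) (hb : ∀ y, ‖m y‖ ≤ 1)
    {x a b u v ν : ℂ} (h : HasJump m x a b ν)
    (huv : ∀ ε > 0, ∀ᶠ y in 𝓝 x, ‖m y - u‖ < ε ∨ ‖m y - v‖ < ε) : ‖a - b‖ = ‖u - v‖ := by
  rcases h.eq_or_eq hm hb huv with ⟨rfl, rfl⟩ | ⟨rfl, rfl⟩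
  · rfl
  · exact norm_sub_rev _ _

/-- All jump triples at `x` have the traces `u` and `v` in some order, so the choice made in
`jumpSize` is immaterial. -/
theorem jumpSize_eq {m : ℂ → ℂ} (hm : Measurable m) (hb : ∀ y, ‖m y‖ ≤ 1) {x u v : ℂ}
    (h : ∃ a b ν : ℂ, HasJump m x a b ν)
    (huv : ∀ ε > 0, ∀ᶠ y in 𝓝 x, ‖m y - u‖ < ε ∨ ‖m y - v‖ < ε) :
    jumpSize m x = ‖u - v‖ := by
  obtain ⟨a, b, ν, hj⟩ := h
  have hex : ∃ t : ℝ, ∃ a b ν : ℂ, HasJump m x a b ν ∧ t = ‖a - b‖ := ⟨_, a, b, ν, hj, rfl⟩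
  rw [jumpSize, dif_pos hex]
  obtain ⟨a', b', ν', hj', he⟩ := hex.choose_spec
  rw [he, hj'.norm_sub_eq hm hb huv]

theorem not_hasJump_of_continuousAt {m : ℂ → ℂ} (hm : Measurable m) (hb : ∀ y, ‖m y‖ ≤ 1)
    {x : ℂ} (hx : ContinuousAt m x) : ¬ ∃ a b ν : ℂ, HasJump m x a b ν := by
  rintro ⟨a, b, ν, h⟩
  have huv : ∀ ε > 0, ∀ᶠ y in 𝓝 x, ‖m y - m x‖ < ε ∨ ‖m y - m x‖ < ε := fun ε hε => by
    simpa only [dist_eq_norm, or_self] using Metric.tendsto_nhds.1 hx ε hε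
  rcases h.eq_or_eq hm hb huv with ⟨rfl, h'⟩ | ⟨rfl, h'⟩ <;> exact h.ne h'.symm

/-! ### Invariance under changes of the field on null sets. -/

section Congr

variable {Ω : Set ℂ} {m m' : ℂ → ℂ}

theorem setAverage_congr_of_ae_eq {s : Set ℂ} (h : m =ᵐ[volume.restrict Ω] m') (hs : s ⊆ Ω)
    (a : ℂ) : ⨍ y in s, ‖m y - a‖ = ⨍ y in s, ‖m' y - a‖ := by
  refine average_congr ?_
  filter_upwards [ae_restrict_of_ae_restrict_of_subset hs h] with y hy
  rw [hy]

theorem HasJump.congr (h : m =ᵐ[volume.restrict Ω] m') (hΩ : IsOpen Ω) {x a b ν : ℂ}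
    (hx : x ∈ Ω) (hj : HasJump m x a b ν) : HasJump m' x a b ν := by
  obtain ⟨δ, hδ, hδ'⟩ := Metric.isOpen_iff.1 hΩ x hx
  refine ⟨hj.norm_normal, hj.ne, hj.plus.congr' ?_, hj.minus.congr' ?_⟩
  all_goals
    filter_upwards [Ioc_mem_nhdsGT hδ] with r hr
    exact setAverage_congr_of_ae_eq h
      (inter_subset_left.trans ((Metric.ball_subset_ball hr.2).trans hδ')) _

theorem hasJump_congr (h : m =ᵐ[volume.restrict Ω] m') (hΩ : IsOpen Ω) {x a b ν : ℂ}
    (hx : x ∈ Ω) : HasJump m x a b ν ↔ HasJump m' x a b ν :=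
  ⟨HasJump.congr h hΩ hx, HasJump.congr h.symm hΩ hx⟩

open Classical in
theorem jumpSize_congr (h : m =ᵐ[volume.restrict Ω] m') (hΩ : IsOpen Ω) {x : ℂ}
    (hx : x ∈ Ω) : jumpSize m x = jumpSize m' x := by
  -- Equal predicates have the same chosen witness, so uniqueness of the jump size is not needed
  -- here.
  have key : ∀ P Q : ℝ → Prop, P = Q →
      (if h : ∃ t, P t then h.choose else 0) = if h : ∃ t, Q t then h.choose else 0 := by
    rintro P _ rfl; rfl
  refine key _ _ (funext fun t => ?_)
  simp only [hasJump_congr h hΩ hx]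

theorem IsBoundaryTrace.congr (h : m =ᵐ[volume.restrict Ω] m') {x a : ℂ}
    (ht : IsBoundaryTrace Ω m x a) : IsBoundaryTrace Ω m' x a :=
  Tendsto.congr (fun _ => setAverage_congr_of_ae_eq h inter_subset_left _) ht

theorem mem_fieldSet_congr (h : m =ᵐ[volume.restrict Ω] m') (hm : m ∈ fieldSet Ω) :
    m' ∈ fieldSet Ω := by
  obtain ⟨⟨hi, K, hK⟩, h1, hd⟩ := hm
  refine ⟨⟨hi.congr h, K, fun ψ hψ hψ1 => ?_⟩, ?_, fun ψ hψ => ?_⟩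
  · have e : ∀ v, ∫ x in Ω, fderiv ℝ ψ x v • m' x = ∫ x in Ω, fderiv ℝ ψ x v • m x := fun v => by
      refine integral_congr_ae ?_
      filter_upwards [h] with x hx
      rw [hx]
    rw [e, e]
    exact hK ψ hψ hψ1
  · filter_upwards [h, h1] with x hx hx1
    rwa [← hx]
  · rw [← hd ψ hψ]
    refine integral_congr_ae ?_
    filter_upwards [h] with x hx
    rw [hx]

theorem mem_tangentFieldSet_congr (h : m =ᵐ[volume.restrict Ω] m')
    (hm : m ∈ tangentFieldSet Ω) : m' ∈ tangentFieldSet Ω := by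
  refine ⟨mem_fieldSet_congr h hm.1, ?_⟩
  filter_upwards [hm.2] with x hx
  obtain ⟨a, n, ha, hn, h0⟩ := hx
  exact ⟨a, n, ha.congr h, hn, h0⟩

end Congr

/-! ### The support function of the arc and the geometry of the drop. -/

/-- `c` and `σ` are the cosine and the sine of an acute angle. -/
structure IsAcutePair (c σ : ℝ) : Prop where
  cos_pos : 0 < c
  sin_pos : 0 < σ
  sq_add_sq : c ^ 2 + σ ^ 2 = 1

/-- The radial field `x / |x|`. -/
noncomputable def radial (x : ℂ) : ℂ := ‖x‖⁻¹ • x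

/-- The corner `c ± iσ` of the arc that lies on the side of `x`. -/
noncomputable def corner (c σ : ℝ) (x : ℂ) : ℂ := if 0 ≤ x.im then ⟨c, σ⟩ else ⟨c, -σ⟩

/-- The point of the arc `{|a| = 1, re a ≤ c}` that maximizes the inner product with `x`. -/
noncomputable def arcNormal (c σ : ℝ) (x : ℂ) : ℂ :=
  if c * |x.im| ≤ σ * x.re then corner c σ x else radial x

/-- The support function of the arc `{|a| = 1, re a ≤ c}`. -/
noncomputable def arcSupport (c σ : ℝ) (x : ℂ) : ℝ := inner ℝ (arcNormal c σ x) x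

/-- The drop in terms of the support function of the arc. -/
def drop (c σ : ℝ) : Set ℂ := {x | arcSupport c σ x < 1}

theorem inner_eq_re_im (x y : ℂ) : inner ℝ x y = x.re * y.re + x.im * y.im := by
  simp [Complex.inner]; ring

theorem norm_sq_eq_re_im (x : ℂ) : ‖x‖ ^ 2 = x.re ^ 2 + x.im ^ 2 := by
  rw [Complex.sq_norm, Complex.normSq_apply]; ring

theorem norm_radial {x : ℂ} (hx : x ≠ 0) : ‖radial x‖ = 1 := by
  rw [radial, norm_smul, norm_inv, norm_norm, inv_mul_cancel₀ (norm_ne_zero_iff.2 hx)]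

theorem norm_radial_le (x : ℂ) : ‖radial x‖ ≤ 1 := by
  by_cases hx : x = 0
  · simp [radial, hx]
  · exact (norm_radial hx).le

theorem inner_radial_self (x : ℂ) : inner ℝ (radial x) x = ‖x‖ := by
  by_cases hx : x = 0
  · simp [hx]
  · rw [radial, real_inner_smul_left, real_inner_self_eq_norm_sq, sq, ← mul_assoc,
      inv_mul_cancel₀ (norm_ne_zero_iff.2 hx), one_mul]

theorem inner_le_norm_of_norm_le_one {a : ℂ} (ha : ‖a‖ ≤ 1) (x : ℂ) : inner ℝ a x ≤ ‖x‖ :=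
  (real_inner_le_norm a x).trans (mul_le_of_le_one_left (norm_nonneg x) ha)

theorem measurable_radial : Measurable radial :=
  measurable_norm.inv.smul measurable_id

theorem continuousAt_radial {x : ℂ} (hx : x ≠ 0) : ContinuousAt radial x :=
  (continuous_norm.continuousAt.inv₀ (norm_ne_zero_iff.2 hx)).smul continuousAt_id

theorem isSubgradientField_radial : IsSubgradientField 1 (fun x => ‖x‖) radial where
  measurable := measurable_radial
  norm_le x := norm_radial_le x
  le x y := by
    rw [inner_sub_right, inner_radial_self, add_sub_cancel]
    exact inner_le_norm_of_norm_le_one (norm_radial_le x) y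

theorem measurable_corner (c σ : ℝ) : Measurable (corner c σ) :=
  Measurable.ite (measurableSet_le measurable_const Complex.measurable_im)
    measurable_const measurable_const

theorem measurableSet_cone (c σ : ℝ) : MeasurableSet {x : ℂ | c * |x.im| ≤ σ * x.re} :=
  (isClosed_le (by fun_prop) (by fun_prop)).measurableSet

theorem measurable_arcNormal (c σ : ℝ) : Measurable (arcNormal c σ) :=
  Measurable.ite (measurableSet_cone c σ) (measurable_corner c σ) measurable_radial

theorem continuousAt_corner (c σ : ℝ) {x : ℂ} (hx : x.im ≠ 0) : ContinuousAt (corner c σ) x := by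
  rcases hx.lt_or_gt with h | h
  · refine continuousAt_const.congr (f := fun _ => (⟨c, -σ⟩ : ℂ)) ?_
    filter_upwards [(isOpen_lt Complex.continuous_im continuous_const).mem_nhds h] with y hy
    exact (if_neg (not_le.2 hy)).symm
  · refine continuousAt_const.congr (f := fun _ => (⟨c, σ⟩ : ℂ)) ?_
    filter_upwards [(isOpen_lt continuous_const Complex.continuous_im).mem_nhds h] with y hy
    exact (if_pos (le_of_lt hy)).symm

section

variable {c σ : ℝ}

theorem corner_re (x : ℂ) : (corner c σ x).re = c := by
  unfold corner; split_ifs <;> rfl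

theorem inner_corner_self (x : ℂ) : inner ℝ (corner c σ x) x = c * x.re + σ * |x.im| := by
  unfold corner
  split_ifs with h
  · rw [inner_eq_re_im, abs_of_nonneg h]
  · rw [inner_eq_re_im, abs_of_neg (not_le.1 h)]; ring

namespace IsAcutePair

theorem norm_corner (h : IsAcutePair c σ) (x : ℂ) : ‖corner c σ x‖ = 1 := by
  have h1 : ‖corner c σ x‖ ^ 2 = 1 ^ 2 := by
    rw [norm_sq_eq_re_im, one_pow, ← h.sq_add_sq]
    unfold corner; split_ifs <;> simp
  exact (sq_eq_sq₀ (norm_nonneg _) zero_le_one).1 h1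

theorem norm_arcNormal (h : IsAcutePair c σ) (x : ℂ) : ‖arcNormal c σ x‖ = 1 := by
  unfold arcNormal
  split_ifs with hx
  · exact h.norm_corner x
  · exact norm_radial fun h0 => hx (by simp [h0])

theorem re_arcNormal_le (h : IsAcutePair c σ) (x : ℂ) : (arcNormal c σ x).re ≤ c := by
  unfold arcNormal
  split_ifs with hx
  · exact (corner_re x).le
  · push Not at hx
    have hx0 : 0 < ‖x‖ := norm_pos_iff.2 fun h0 => by simp [h0] at hx
    have hle : x.re ≤ c * ‖x‖ := by
      rcases le_or_gt x.re 0 with h0 | h0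
      · exact h0.trans (mul_nonneg h.cos_pos.le hx0.le)
      · have hsq : (σ * x.re) ^ 2 ≤ (c * |x.im|) ^ 2 :=
          pow_le_pow_left₀ (mul_nonneg h.sin_pos.le h0.le) hx.le 2
        refine le_of_sq_le_sq ?_ (mul_nonneg h.cos_pos.le hx0.le)
        rw [mul_pow, norm_sq_eq_re_im]
        rw [mul_pow, mul_pow, sq_abs] at hsq
        have := h.sq_add_sq
        have e : σ ^ 2 = 1 - c ^ 2 := by linarith
        rw [e] at hsq
        linarith
    show (‖x‖⁻¹ • x).re ≤ c
    rw [Complex.smul_re, smul_eq_mul, inv_mul_le_iff₀ hx0, mul_comm]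
    exact hle

theorem re_nonneg_of_cone (h : IsAcutePair c σ) {x : ℂ} (hx : c * |x.im| ≤ σ * x.re) :
    0 ≤ x.re := by
  have : 0 ≤ σ * x.re := (mul_nonneg h.cos_pos.le (abs_nonneg _)).trans hx
  exact nonneg_of_mul_nonneg_right this h.sin_pos

theorem inner_le_arcSupport (h : IsAcutePair c σ) {a : ℂ} (ha : ‖a‖ = 1) (hac : a.re ≤ c)
    (x : ℂ) : inner ℝ a x ≤ arcSupport c σ x := by
  unfold arcSupport arcNormal
  split_ifs with hx
  · rw [inner_corner_self, inner_eq_re_im]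
    have h1 : a.re ^ 2 + a.im ^ 2 = 1 := by rw [← norm_sq_eq_re_im, ha, one_pow]
    have h2 : c * a.re + σ * |a.im| ≤ 1 := by
      nlinarith [sq_nonneg (c - a.re), sq_nonneg (σ - |a.im|), sq_abs a.im, h.sq_add_sq]
    have h3 : a.im * x.im ≤ |a.im| * |x.im| := by
      rw [← abs_mul]; exact le_abs_self _
    -- After folding `im x` to `|im x|`, `σ • x` is a combination of `1` and the corner with the
    -- nonnegative coefficients `σ * re x - c * |im x|` and `|im x|`; the corner beats `a` against
    -- each of them.
    have h4 : 0 ≤ σ * ((c - a.re) * x.re + (σ - |a.im|) * |x.im|) := by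
      have e : σ * ((c - a.re) * x.re + (σ - |a.im|) * |x.im|)
          = (σ * x.re - c * |x.im|) * (c - a.re)
            + |x.im| * (c ^ 2 + σ ^ 2 - (c * a.re + σ * |a.im|)) := by ring
      rw [e, h.sq_add_sq]
      have := abs_nonneg x.im
      exact add_nonneg (mul_nonneg (by linarith) (by linarith)) (mul_nonneg this (by linarith))
    have h5 := nonneg_of_mul_nonneg_right h4 h.sin_pos
    linarith
  · rw [inner_radial_self]
    exact inner_le_norm_of_norm_le_one ha.le x

theorem inner_arcNormal_le (h : IsAcutePair c σ) (x y : ℂ) :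
    inner ℝ (arcNormal c σ x) y ≤ arcSupport c σ y :=
  h.inner_le_arcSupport (h.norm_arcNormal x) (h.re_arcNormal_le x) y

/-- `arcNormal c σ x` attains the maximum that gives the support function at `x`, and is an
admissible competitor for the one at `y`. -/
theorem isSubgradientField (h : IsAcutePair c σ) :
    IsSubgradientField 1 (arcSupport c σ) (arcNormal c σ) where
  measurable := measurable_arcNormal c σ
  norm_le x := (h.norm_arcNormal x).le
  le x y := by
    rw [inner_sub_right]
    have := h.inner_arcNormal_le x y
    unfold arcSupport at this ⊢
    linarith

theorem arcSupport_le_norm (h : IsAcutePair c σ) (x : ℂ) : arcSupport c σ x ≤ ‖x‖ :=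
  inner_le_norm_of_norm_le_one (h.norm_arcNormal x).le x

theorem arcSupport_nonneg (h : IsAcutePair c σ) (x : ℂ) : 0 ≤ arcSupport c σ x := by
  unfold arcSupport arcNormal
  split_ifs with hx
  · rw [inner_corner_self]
    exact add_nonneg (mul_nonneg h.cos_pos.le (h.re_nonneg_of_cone hx))
      (mul_nonneg h.sin_pos.le (abs_nonneg _))
  · rw [inner_radial_self]; exact norm_nonneg x

theorem continuous_arcSupport (h : IsAcutePair c σ) : Continuous (arcSupport c σ) :=
  h.isSubgradientField.lipschitzWith.continuous

theorem arcSupport_combo_le (h : IsAcutePair c σ) {r s : ℝ} (hr : 0 ≤ r) (hs : 0 ≤ s) (x y : ℂ) :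
    arcSupport c σ (r • x + s • y) ≤ r * arcSupport c σ x + s * arcSupport c σ y := by
  conv_lhs => unfold arcSupport
  rw [inner_add_right, real_inner_smul_right, real_inner_smul_right]
  gcongr <;> exact h.inner_arcNormal_le _ _

theorem corner_eq_radial (h : IsAcutePair c σ) {x : ℂ} (hx : c * |x.im| = σ * x.re)
    (h0 : x.im ≠ 0) : corner c σ x = radial x := by
  have hs := h.sin_pos.ne'
  have e : x = (|x.im| / σ) • corner c σ x := by
    have hre : x.re = |x.im| / σ * c := by field_simp; linarith
    apply Complex.ext
    · rw [Complex.smul_re, corner_re]; exact hre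
    · unfold corner
      split_ifs with hi
      · simp [abs_of_nonneg hi]; field_simp
      · simp [abs_of_neg (not_le.1 hi)]; field_simp
  have hpos : 0 < |x.im| / σ := div_pos (abs_pos.2 h0) h.sin_pos
  have hn : ‖x‖ = |x.im| / σ := by
    conv_lhs => rw [e]
    rw [norm_smul, h.norm_corner, mul_one, Real.norm_of_nonneg hpos.le]
  rw [radial, hn]
  exact (eq_inv_smul_iff₀ hpos.ne').2 e.symm

/-- The corner and radial formulas agree on the sides of the cone (`corner_eq_radial`), so
discontinuities can lie only on the nonnegative real axis. -/
theorem continuousAt_arcNormal (h : IsAcutePair c σ) {x : ℂ} (hx : x.im ≠ 0 ∨ x.re < 0) :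
    ContinuousAt (arcNormal c σ) x := by
  have hcl : IsClosed {y : ℂ | c * |y.im| ≤ σ * y.re} := isClosed_le (by fun_prop) (by fun_prop)
  have hop : IsOpen {y : ℂ | c * |y.im| < σ * y.re} := isOpen_lt (by fun_prop) (by fun_prop)
  by_cases hS : c * |x.im| ≤ σ * x.re
  · have hi : x.im ≠ 0 := hx.resolve_right (not_lt.2 (h.re_nonneg_of_cone hS))
    have hcor := continuousAt_corner c σ hi
    rcases hS.lt_or_eq with hlt | heq
    · refine hcor.congr ?_
      filter_upwards [hop.mem_nhds hlt] with y hy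
      exact (if_pos (le_of_lt hy)).symm
    · have h0 : x ≠ 0 := fun h0 => hi (by simp [h0])
      have hrad := continuousAt_radial h0
      have hval : arcNormal c σ x = corner c σ x := if_pos hS
      unfold ContinuousAt at hcor hrad ⊢
      rw [← h.corner_eq_radial heq hi] at hrad
      rw [hval]
      exact Tendsto.if' hcor hrad
  · have h0 : x ≠ 0 := fun h0 => hS (by simp [h0])
    refine (continuousAt_radial h0).congr ?_
    filter_upwards [hcl.isOpen_compl.mem_nhds hS] with y hy
    exact (if_neg hy).symm

theorem isOpen_drop (h : IsAcutePair c σ) : IsOpen (drop c σ) :=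
  isOpen_lt h.continuous_arcSupport continuous_const

theorem frontier_drop (h : IsAcutePair c σ) : frontier (drop c σ) = {x | arcSupport c σ x = 1} := by
  refine Subset.antisymm (frontier_lt_subset_eq h.continuous_arcSupport continuous_const) ?_
  intro x hx
  rw [frontier, h.isOpen_drop.interior_eq]
  refine ⟨?_, fun hx' => (ne_of_lt hx') hx⟩
  refine mem_closure_of_tendsto (f := fun r : ℝ => r • x) (b := 𝓝[<] 1) ?_ ?_
  · have : Tendsto (fun r : ℝ => r • x) (𝓝 1) (𝓝 ((1 : ℝ) • x)) :=
      (continuous_id.smul continuous_const).continuousAt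
    rw [one_smul] at this
    exact this.mono_left nhdsWithin_le_nhds
  · filter_upwards [Ioo_mem_nhdsLT (zero_lt_one' ℝ)] with r hr
    have := h.arcSupport_combo_le hr.1.le le_rfl x x
    rw [zero_smul, add_zero, zero_mul, add_zero, show arcSupport c σ x = 1 from hx,
      mul_one] at this
    exact this.trans_lt hr.2

/-- Since the support function is also `1`-Lipschitz, a step along the normal raises it at exactly
unit rate. This gives the distance to the boundary, and shows that the level `1` is not in the
interior of the hull. -/
theorem arcSupport_add_smul_arcNormal_ge (h : IsAcutePair c σ) (x : ℂ) (t : ℝ) :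
    arcSupport c σ x + t ≤ arcSupport c σ (x + t • arcNormal c σ x) := by
  have := h.inner_arcNormal_le x (x + t • arcNormal c σ x)
  rwa [inner_add_right, real_inner_smul_right, real_inner_self_eq_norm_sq, h.norm_arcNormal,
    one_pow, mul_one] at this

/-- The distance to the boundary of the drop. -/
theorem infDist_frontier_drop (h : IsAcutePair c σ) {x : ℂ} (hx : x ∈ drop c σ) :
    Metric.infDist x (frontier (drop c σ)) = 1 - arcSupport c σ x := by
  have hx1 : arcSupport c σ x < 1 := hx
  rw [h.frontier_drop]
  -- The nearest boundary point, reached along the normal at unit rate.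
  set z := x + (1 - arcSupport c σ x) • arcNormal c σ x with hz
  have hdist : dist x z = 1 - arcSupport c σ x := by
    rw [hz, dist_self_add_right, norm_smul, h.norm_arcNormal, mul_one,
      Real.norm_of_nonneg (by linarith)]
  have hlip : ∀ y, arcSupport c σ y - arcSupport c σ x ≤ dist x y := fun y => by
    have := h.isSubgradientField.lipschitzWith.dist_le_mul y x
    rw [NNReal.coe_one, one_mul, dist_comm y x, Real.dist_eq] at this
    exact (le_abs_self _).trans this
  have hz1 : z ∈ {y | arcSupport c σ y = 1} := by
    have h1 := h.arcSupport_add_smul_arcNormal_ge x (1 - arcSupport c σ x)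
    have h2 := hlip z
    rw [hdist] at h2
    show arcSupport c σ z = 1
    rw [← hz] at h1
    linarith
  refine le_antisymm (hdist ▸ Metric.infDist_le_dist_of_mem hz1) ?_
  refine (Metric.le_infDist ⟨z, hz1⟩).2 fun y hy => ?_
  rw [← show arcSupport c σ y = 1 from hy]
  exact hlip y

theorem corner_mem_sphere (h : IsAcutePair c σ) (x : ℂ) : corner c σ x ∈ Metric.sphere (0 : ℂ) 1 := by
  rw [mem_sphere_zero_iff_norm, h.norm_corner]

theorem arcSupport_of_cone {x : ℂ} (hx : c * |x.im| ≤ σ * x.re) :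
    arcSupport c σ x = c * x.re + σ * |x.im| := by
  unfold arcSupport arcNormal
  rw [if_pos hx, inner_corner_self]

theorem arcSupport_of_not_cone {x : ℂ} (hx : ¬ c * |x.im| ≤ σ * x.re) :
    arcSupport c σ x = ‖x‖ := by
  unfold arcSupport arcNormal
  rw [if_neg hx, inner_radial_self]

theorem arcSupport_ofReal (h : IsAcutePair c σ) {s : ℝ} (hs : 0 ≤ s) :
    arcSupport c σ (s : ℂ) = c * s := by
  rw [arcSupport_of_cone] <;> simp
  exact mul_nonneg h.sin_pos.le hs

theorem convexHull_eq (h : IsAcutePair c σ) :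
    convexHull ℝ (Metric.sphere (0 : ℂ) 1 ∪ {((1 / c : ℝ) : ℂ)}) = {x | arcSupport c σ x ≤ 1} := by
  refine Subset.antisymm (convexHull_min ?_ ?_) ?_
  · rintro x (hx | rfl)
    · exact (h.arcSupport_le_norm x).trans (mem_sphere_zero_iff_norm.1 hx).le
    · show arcSupport c σ ((1 / c : ℝ) : ℂ) ≤ 1
      rw [h.arcSupport_ofReal (one_div_pos.2 h.cos_pos).le, mul_one_div_cancel h.cos_pos.ne']
  · intro x hx y hy r s hr hs hrs
    have hx' : arcSupport c σ x ≤ 1 := hx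
    have hy' : arcSupport c σ y ≤ 1 := hy
    refine (h.arcSupport_combo_le hr hs x y).trans ?_
    nlinarith
  · intro x hx
    have hx1 : arcSupport c σ x ≤ 1 := hx
    have hball : Metric.closedBall (0 : ℂ) 1
        ⊆ convexHull ℝ (Metric.sphere (0 : ℂ) 1 ∪ {((1 / c : ℝ) : ℂ)}) := by
      rw [← convexHull_sphere_eq_closedBall (0 : ℂ) zero_le_one]
      exact convexHull_mono subset_union_left
    by_cases hS : c * |x.im| ≤ σ * x.re
    · rw [arcSupport_of_cone hS] at hx1
      have hc := h.cos_pos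
      have hs := h.sin_pos
      have hp : corner c σ x ∈ convexHull ℝ (Metric.sphere (0 : ℂ) 1 ∪ {((1 / c : ℝ) : ℂ)}) :=
        subset_convexHull ℝ _ (Or.inl (h.corner_mem_sphere x))
      have hB : ((1 / c : ℝ) : ℂ) ∈ convexHull ℝ (Metric.sphere (0 : ℂ) 1 ∪ {((1 / c : ℝ) : ℂ)}) :=
        subset_convexHull ℝ _ (Or.inr rfl)
      have h0 := hball (Metric.mem_closedBall_self zero_le_one)
      -- Coordinates in the triangle with vertices `0`, the corner and `B`: `x = l • corner + μ •
      -- B`, and `l + μ` is the support function at `x`, hence at most `1`.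
      set l := |x.im| / σ with hl
      set μ := c * (x.re - l * c) with hμ
      have hl0 : 0 ≤ l := div_nonneg (abs_nonneg _) hs.le
      have hlσ : l * σ = |x.im| := div_mul_cancel₀ _ hs.ne'
      have hμ0 : 0 ≤ μ := by
        refine mul_nonneg hc.le (sub_nonneg.2 ?_)
        rw [hl, div_mul_eq_mul_div, div_le_iff₀ hs]
        linarith
      have hsum : l + μ = c * x.re + σ * |x.im| := by
        rw [hμ, ← hlσ]
        have := h.sq_add_sq
        linear_combination (-l) * this
      have hmem := (convex_convexHull ℝ (Metric.sphere (0 : ℂ) 1 ∪ {((1 / c : ℝ) : ℂ)})).sum_mem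
        (t := Finset.univ) (w := ![l, μ, 1 - l - μ])
        (z := ![corner c σ x, ((1 / c : ℝ) : ℂ), 0])
        (by
          intro i _
          fin_cases i
          · exact hl0
          · exact hμ0
          · show 0 ≤ 1 - l - μ
            linarith)
        (by simp [Fin.sum_univ_three])
        (by
          intro i _
          fin_cases i
          · exact hp
          · exact hB
          · exact h0)
      convert hmem using 1
      simp only [Fin.sum_univ_three, Matrix.cons_val]
      apply Complex.ext
      · simp only [Complex.add_re, Complex.smul_re, corner_re, Complex.ofReal_re, Complex.zero_re,
          smul_eq_mul, hμ]
        field_simp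
        ring
      · have him : (corner c σ x).im * l = x.im := by
          unfold corner
          split_ifs with hi
          · rw [mul_comm]; exact hlσ.trans (abs_of_nonneg hi)
          · have := abs_of_neg (not_le.1 hi)
            show -σ * l = x.im
            linarith
        simp only [Complex.add_im, Complex.smul_im, Complex.ofReal_im, Complex.zero_im,
          smul_eq_mul]
        linarith
    · rw [arcSupport_of_not_cone hS] at hx1
      exact hball (mem_closedBall_zero_iff.2 hx1)

theorem interior_convexHull_eq (h : IsAcutePair c σ) :
    interior (convexHull ℝ (Metric.sphere (0 : ℂ) 1 ∪ {((1 / c : ℝ) : ℂ)})) = drop c σ := by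
  rw [h.convexHull_eq]
  refine Subset.antisymm (fun x hx => ?_)
    (interior_maximal (fun x hx => le_of_lt (show arcSupport c σ x < 1 from hx)) h.isOpen_drop)
  obtain ⟨δ, hδ, hδ'⟩ := Metric.mem_nhds_iff.1 (mem_interior_iff_mem_nhds.1 hx)
  have hmem : x + (δ / 2) • arcNormal c σ x ∈ Metric.ball x δ := by
    rw [mem_ball_iff_norm, add_sub_cancel_left, norm_smul, h.norm_arcNormal, mul_one,
      Real.norm_of_nonneg (by linarith)]
    linarith
  have h1 : arcSupport c σ (x + (δ / 2) • arcNormal c σ x) ≤ 1 := hδ' hmem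
  have h2 := h.arcSupport_add_smul_arcNormal_ge x (δ / 2)
  show arcSupport c σ x < 1
  linarith

theorem isBounded_drop (h : IsAcutePair c σ) : Bornology.IsBounded (drop c σ) := by
  rw [← h.interior_convexHull_eq]
  exact ((isBounded_convexHull.2 (Metric.isBounded_sphere.union
    Bornology.isBounded_singleton))).subset interior_subset

/-- The viscosity solution on the drop. -/
theorem viscositySolution_ae_eq (h : IsAcutePair c σ) :
    (fun x => -(Complex.I * arcNormal c σ x))
      =ᵐ[volume.restrict (drop c σ)] viscositySolution (drop c σ) := by
  rw [Filter.EventuallyEq, ae_restrict_iff' h.isOpen_drop.measurableSet]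
  filter_upwards [h.isSubgradientField.lipschitzWith.ae_differentiableAt (μ := volume)] with x hd hx
  have h1 : HasGradientAt (arcSupport c σ) (arcNormal c σ x) x := by
    rw [hasGradientAt_iff_hasFDerivAt]
    have e : InnerProductSpace.toDual ℝ ℂ (arcNormal c σ x) = fderiv ℝ (arcSupport c σ) x := by
      refine ContinuousLinearMap.ext fun v => ?_
      rw [h.isSubgradientField.fderiv_apply hd, InnerProductSpace.toDual_apply_apply]
    rw [e]
    exact hd.hasFDerivAt
  have h2 : HasGradientAt (fun y => Metric.infDist y (frontier (drop c σ)))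
      (-arcNormal c σ x) x := by
    rw [hasGradientAt_iff_hasFDerivAt] at h1 ⊢
    rw [map_neg]
    refine (h1.const_sub 1).congr_of_eventuallyEq ?_
    filter_upwards [h.isOpen_drop.mem_nhds hx] with y hy
    exact h.infDist_frontier_drop hy
  rw [viscositySolution, h2.gradient, mul_neg]

/-- The subgradient inequality at `x` puts the drop on one side of the tangent. The inequality at
`y`, with continuity of the normal, puts the complement on the other side up to `ε * ‖y - x‖`. -/
theorem isOuterNormal (h : IsAcutePair c σ) {x : ℂ} (hx : arcSupport c σ x = 1)
    (hcont : ContinuousAt (arcNormal c σ) x) : IsOuterNormal (drop c σ) x (arcNormal c σ x) := by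
  refine ⟨h.norm_arcNormal x, fun ε hε => ?_⟩
  filter_upwards [Metric.tendsto_nhds.1 hcont ε hε] with y hy
  have hpos : 0 ≤ ε * ‖y - x‖ := by positivity
  refine ⟨fun hyΩ => ?_, fun hyΩ => ?_⟩
  · have hyΩ' : arcSupport c σ y < 1 := hyΩ
    have := h.isSubgradientField.le x y
    rw [real_inner_comm] at this
    linarith
  · have h1 := h.isSubgradientField.le y x
    have h2 : 1 ≤ arcSupport c σ y := not_lt.1 hyΩ
    have h3 : inner ℝ (arcNormal c σ y - arcNormal c σ x) (y - x) ≤ ε * ‖y - x‖ := by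
      refine (real_inner_le_norm _ _).trans ?_
      rw [← dist_eq_norm]
      gcongr
    rw [← neg_sub y x, inner_neg_right] at h1
    rw [inner_sub_left] at h3
    rw [real_inner_comm]
    linarith

end IsAcutePair

theorem dropDomain_eq_drop {θ : ℝ} (h : IsAcutePair (Real.cos θ) |Real.sin θ|) :
    dropDomain θ = drop (Real.cos θ) |Real.sin θ| :=
  h.interior_convexHull_eq

end
-- The two fields and their membership in `A₀`.
/-- The field `-i N`, which represents the viscosity solution on the drop. -/
noncomputable def viscosityField (c σ : ℝ) (x : ℂ) : ℂ := -(Complex.I * arcNormal c σ x)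

/-- The rotated gradient of `max (1 - |x|) (h - 1)`, where `h` is the support function of the
arc: a vortex around `0` that turns back across a parabolic ridge near the corner of the drop. -/
noncomputable def competitor (c σ : ℝ) (x : ℂ) : ℂ :=
  if arcSupport c σ x + ‖x‖ < 2 then -(Complex.I * radial x) else Complex.I * arcNormal c σ x

/-- The subgradients of `max 2 (h + |x|)`. -/
noncomputable def ridgeGradient (c σ : ℝ) (x : ℂ) : ℂ :=
  if arcSupport c σ x + ‖x‖ < 2 then 0 else arcNormal c σ x + radial x

theorem inner_I_mul_self (n : ℂ) : inner ℝ (Complex.I * n) n = 0 := by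
  simp [Complex.inner]; ring

theorem tendsto_neg_I_mul {l : Filter ℂ} {f : ℂ → ℂ} {a : ℂ} (h : Tendsto f l (𝓝 a)) :
    Tendsto (fun y => -(Complex.I * f y)) l (𝓝 (-(Complex.I * a))) :=
  (h.const_mul _).neg

section

variable {c σ : ℝ}

theorem measurableSet_arcSupport_add_norm_lt (h : IsAcutePair c σ) :
    MeasurableSet {x : ℂ | arcSupport c σ x + ‖x‖ < 2} :=
  (isOpen_lt (h.continuous_arcSupport.add continuous_norm) continuous_const).measurableSet

theorem isSubgradientField_ridgeGradient (h : IsAcutePair c σ) :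
    IsSubgradientField 2 (fun x => max 2 (arcSupport c σ x + ‖x‖)) (ridgeGradient c σ) where
  measurable := Measurable.ite (measurableSet_arcSupport_add_norm_lt h) measurable_const
    ((measurable_arcNormal c σ).add measurable_radial)
  norm_le x := by
    unfold ridgeGradient
    split_ifs with hx
    · simp
    · refine (norm_add_le _ _).trans ?_
      rw [h.norm_arcNormal]
      have := norm_radial_le x
      norm_num
      linarith
  le x y := by
    unfold ridgeGradient
    split_ifs with hx
    · rw [inner_zero_left, add_zero, max_eq_left hx.le]
      exact le_max_left _ _
    · rw [max_eq_right (not_lt.1 hx), inner_add_left]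
      refine le_trans ?_ (le_max_right _ _)
      have h1 := h.isSubgradientField.le x y
      have h2 := isSubgradientField_radial.le x y
      linarith

/-- Gradient form of `max (1 - |x|) (h - 1) = max 2 (h + |x|) - 1 - |x|`, a difference of convex
functions up to a constant. -/
theorem competitor_eq (c σ : ℝ) :
    competitor c σ = fun x => Complex.I * ridgeGradient c σ x + -(Complex.I * radial x) := by
  ext1 x
  unfold competitor ridgeGradient
  split_ifs with hx
  · simp
  · ring

theorem measurable_competitor (h : IsAcutePair c σ) : Measurable (competitor c σ) :=
  Measurable.ite (measurableSet_arcSupport_add_norm_lt h) (measurable_radial.const_mul _).neg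
    ((measurable_arcNormal c σ).const_mul _)

theorem measurable_viscosityField (c σ : ℝ) : Measurable (viscosityField c σ) :=
  ((measurable_arcNormal c σ).const_mul _).neg

theorem norm_viscosityField (h : IsAcutePair c σ) (x : ℂ) : ‖viscosityField c σ x‖ = 1 := by
  rw [viscosityField, norm_neg, norm_mul, Complex.norm_I, one_mul, h.norm_arcNormal]

theorem norm_competitor (h : IsAcutePair c σ) {x : ℂ} (hx : x ≠ 0) : ‖competitor c σ x‖ = 1 := by
  unfold competitor
  split_ifs
  · rw [norm_neg, norm_mul, Complex.norm_I, one_mul, norm_radial hx]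
  · rw [norm_mul, Complex.norm_I, one_mul, h.norm_arcNormal]

theorem norm_competitor_le (h : IsAcutePair c σ) (x : ℂ) : ‖competitor c σ x‖ ≤ 1 := by
  by_cases hx : x = 0
  · subst hx
    rw [competitor]
    split_ifs
    · simp [radial]
    · rw [norm_mul, Complex.norm_I, one_mul, h.norm_arcNormal]
  · exact (norm_competitor h hx).le

theorem viscosityField_mem_fieldSet (h : IsAcutePair c σ) :
    viscosityField c σ ∈ fieldSet (drop c σ) :=
  ⟨(h.isSubgradientField.isBV h.isBounded_drop).I_mul.neg,
    Eventually.of_forall (norm_viscosityField h), (h.isSubgradientField.isDivFree _).neg⟩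

theorem competitor_mem_fieldSet (h : IsAcutePair c σ) :
    competitor c σ ∈ fieldSet (drop c σ) := by
  have h1 := (isSubgradientField_ridgeGradient h).isBV h.isBounded_drop |>.I_mul
  have h2 := isSubgradientField_radial.isBV h.isBounded_drop |>.I_mul.neg
  refine ⟨?_, ?_, ?_⟩
  · rw [competitor_eq]
    exact h1.add h2
  · refine ae_restrict_of_ae ?_
    filter_upwards [measure_eq_zero_iff_ae_notMem.1 (measure_singleton (0 : ℂ))] with x hx
    exact norm_competitor h hx
  · rw [competitor_eq]
    exact ((isSubgradientField_ridgeGradient h).isDivFree _).add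
      (isSubgradientField_radial.isDivFree _).neg h1.integrable h2.integrable

theorem eq_ofReal_of_im_eq_zero {x : ℂ} (hx : x.im = 0) : x = (x.re : ℂ) :=
  Complex.ext rfl (by simpa using hx)

theorem ae_hausdorffMeasure_of_countable {s : Set ℂ} (hs : s.Countable) :
    ∀ᵐ x ∂(μH[1] : Measure ℂ), x ∉ s := by
  have := Measure.nullSingletonClass_hausdorff ℂ zero_lt_one
  exact measure_eq_zero_iff_ae_notMem.1 (hs.measure_zero _)

theorem ae_frontier_drop (h : IsAcutePair c σ) {P : ℂ → Prop} {s : Set ℂ} (hs : s.Countable)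
    (hP : ∀ x, arcSupport c σ x = 1 → x ∉ s → P x) :
    ∀ᵐ x ∂((μH[1] : Measure ℂ).restrict (frontier (drop c σ))), P x := by
  rw [ae_restrict_iff' isClosed_frontier.measurableSet]
  filter_upwards [ae_hausdorffMeasure_of_countable hs] with x hx hxf
  rw [h.frontier_drop] at hxf
  exact hP x hxf hx

theorem off_axis_of_ne_apex (h : IsAcutePair c σ) {x : ℂ} (hx : arcSupport c σ x = 1)
    (hne : x ≠ ((1 / c : ℝ) : ℂ)) : x.im ≠ 0 ∨ x.re < 0 := by
  by_contra! h'
  rw [eq_ofReal_of_im_eq_zero h'.1, h.arcSupport_ofReal h'.2] at hx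
  apply hne
  rw [eq_ofReal_of_im_eq_zero h'.1, Complex.ofReal_inj, eq_div_iff h.cos_pos.ne', mul_comm]
  exact hx

theorem viscosityField_mem_tangentFieldSet (h : IsAcutePair c σ) :
    viscosityField c σ ∈ tangentFieldSet (drop c σ) := by
  refine ⟨viscosityField_mem_fieldSet h,
    ae_frontier_drop h (countable_singleton ((1 / c : ℝ) : ℂ)) fun x hx hne => ?_⟩
  have hc := h.continuousAt_arcNormal (off_axis_of_ne_apex h hx hne)
  refine ⟨_, _, isBoundaryTrace_of_tendsto
    ((tendsto_neg_I_mul hc).mono_left nhdsWithin_le_nhds), h.isOuterNormal hx hc, ?_⟩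
  rw [inner_neg_left, inner_I_mul_self, neg_zero]

/-- On the straight edges `|x| > 1 = h`, so nearby the field is `i N`. Near the circular part,
points of the drop have `h = |x| < 1`, so the field is the vortex, with trace `-i N`. The apex and
the two tangency points are negligible. -/
theorem competitor_mem_tangentFieldSet (h : IsAcutePair c σ) :
    competitor c σ ∈ tangentFieldSet (drop c σ) := by
  have hs : ({((1 / c : ℝ) : ℂ), ⟨c, σ⟩, ⟨c, -σ⟩} : Set ℂ).Countable := Set.to_countable _
  refine ⟨competitor_mem_fieldSet h, ae_frontier_drop h hs fun x hx hne => ?_⟩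
  simp only [mem_insert_iff, mem_singleton_iff, not_or] at hne
  have hc := h.continuousAt_arcNormal (off_axis_of_ne_apex h hx hne.1)
  have hn := h.isOuterNormal hx hc
  by_cases hS : c * |x.im| ≤ σ * x.re
  -- If `|x| = 1`, the unit vectors `x` and the corner have inner product `1`, so `x` would be a
  -- tangency point.
  · have hx1 : 1 < ‖x‖ := by
      refine lt_of_le_of_ne (hx ▸ h.arcSupport_le_norm x) fun h1 => ?_
      have h2 : inner ℝ (corner c σ x) x = 1 := by
        rw [inner_corner_self, ← IsAcutePair.arcSupport_of_cone hS, hx]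
      have h3 : corner c σ x = x :=
        (inner_eq_one_iff_of_norm_eq_one (h.norm_corner x) h1.symm).1 h2
      unfold corner at h3
      split_ifs at h3
      · exact hne.2.1 h3.symm
      · exact hne.2.2 h3.symm
    refine ⟨Complex.I * arcNormal c σ x, _, isBoundaryTrace_of_tendsto ?_, hn,
      inner_I_mul_self _⟩
    have hc' : Tendsto (fun y => Complex.I * arcNormal c σ y) (𝓝 x)
      (𝓝 (Complex.I * arcNormal c σ x)) := hc.tendsto.const_mul _
    refine (hc'.congr' ?_).mono_left nhdsWithin_le_nhds
    have hop : IsOpen {y : ℂ | 2 < arcSupport c σ y + ‖y‖} :=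
      isOpen_lt continuous_const (h.continuous_arcSupport.add continuous_norm)
    filter_upwards [hop.mem_nhds (show 2 < arcSupport c σ x + ‖x‖ by linarith)] with y hy
    exact (if_neg (not_lt.2 (le_of_lt hy))).symm
  · refine ⟨-(Complex.I * arcNormal c σ x), _, isBoundaryTrace_of_tendsto ?_, hn, ?_⟩
    · refine ((tendsto_neg_I_mul hc).mono_left nhdsWithin_le_nhds).congr' ?_
      have hcl : IsClosed {y : ℂ | c * |y.im| ≤ σ * y.re} :=
        isClosed_le (by fun_prop) (by fun_prop)
      filter_upwards [mem_nhdsWithin_of_mem_nhds (hcl.isOpen_compl.mem_nhds hS),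
        self_mem_nhdsWithin] with y hy hyΩ
      have hyS : ¬ c * |y.im| ≤ σ * y.re := hy
      have hy1 : arcSupport c σ y < 1 := hyΩ
      have hy2 := IsAcutePair.arcSupport_of_not_cone hyS
      rw [competitor, if_pos (by linarith), arcNormal, if_neg hyS]
    · rw [inner_neg_left, inner_I_mul_self, neg_zero]

/-! ### The jump of the viscosity solution -/

theorem eventually_cone (h : IsAcutePair c σ) {s : ℝ} (hs : 0 < s) :
    ∀ᶠ y in 𝓝 (s : ℂ), c * |y.im| ≤ σ * y.re := by
  have hop : IsOpen {y : ℂ | c * |y.im| < σ * y.re} := isOpen_lt (by fun_prop) (by fun_prop)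
  have hmem : (s : ℂ) ∈ {y : ℂ | c * |y.im| < σ * y.re} := by
    simpa using mul_pos h.sin_pos hs
  filter_upwards [hop.mem_nhds hmem] with y hy
  exact le_of_lt hy

theorem norm_corner_sub (h : IsAcutePair c σ) : ‖(⟨c, σ⟩ : ℂ) - ⟨c, -σ⟩‖ = 2 * σ := by
  have e : (⟨c, σ⟩ : ℂ) - ⟨c, -σ⟩ = (2 * σ : ℝ) • Complex.I := by
    apply Complex.ext <;> simp; ring
  rw [e, norm_smul, Complex.norm_I, mul_one, Real.norm_of_nonneg]
  linarith [h.sin_pos]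

theorem corner_ne (h : IsAcutePair c σ) : (⟨c, σ⟩ : ℂ) ≠ ⟨c, -σ⟩ := fun he => by
  have := norm_corner_sub h
  rw [he, sub_self, norm_zero] at this
  linarith [h.sin_pos]

theorem arcNormal_eq_or {y : ℂ} (hy : c * |y.im| ≤ σ * y.re) :
    arcNormal c σ y = ⟨c, σ⟩ ∨ arcNormal c σ y = ⟨c, -σ⟩ := by
  unfold arcNormal corner
  rw [if_pos hy]
  split_ifs <;> simp

theorem hasJump_viscosityField (h : IsAcutePair c σ) {s : ℝ} (hs : 0 < s) :
    HasJump (viscosityField c σ) s (-(Complex.I * ⟨c, σ⟩)) (-(Complex.I * ⟨c, -σ⟩)) Complex.I := by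
  have hin : ∀ y : ℂ, inner ℝ (y - s) Complex.I = y.im := fun y => by
    rw [inner_eq_re_im]; simp
  refine hasJump_of_tendsto Complex.norm_I ?_ ?_ ?_
  · intro he
    exact corner_ne h (mul_left_cancel₀ Complex.I_ne_zero (neg_injective he))
  all_goals
    refine tendsto_const_nhds.congr' ?_
    filter_upwards [mem_nhdsWithin_of_mem_nhds (eventually_cone h hs), self_mem_nhdsWithin]
      with y hy hyi
    rw [hin] at hyi
    rw [viscosityField, arcNormal, if_pos hy, corner]
  · rw [if_pos hyi.le]
  · rw [if_neg (not_le.2 hyi)]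

theorem jumpSize_viscosityField (h : IsAcutePair c σ) {s : ℝ} (hs : 0 < s) :
    jumpSize (viscosityField c σ) s = 2 * σ := by
  rw [jumpSize_eq (measurable_viscosityField c σ) (fun y => (norm_viscosityField h y).le)
    ⟨_, _, _, hasJump_viscosityField h hs⟩ (u := -(Complex.I * ⟨c, σ⟩))
    (v := -(Complex.I * ⟨c, -σ⟩))]
  · rw [← norm_corner_sub h, neg_sub_neg, ← mul_sub, norm_mul, Complex.norm_I, one_mul,
      norm_sub_rev]
  · intro ε hε
    filter_upwards [eventually_cone h hs] with y hy
    unfold viscosityField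
    rcases arcNormal_eq_or hy with e | e
    · left; rw [e, sub_self, norm_zero]; exact hε
    · right; rw [e, sub_self, norm_zero]; exact hε

theorem hausdorffMeasure_ofReal_Ioo (a b : ℝ) :
    (μH[1] : Measure ℂ) ((fun s : ℝ => (s : ℂ)) '' Ioo a b) = ENNReal.ofReal (b - a) := by
  rw [Complex.isometry_ofReal.hausdorffMeasure_image (Or.inl zero_le_one), hausdorffMeasure_real,
    Real.volume_Ioo]

theorem le_lineEnergy_viscositySolution (h : IsAcutePair c σ) (f : ℝ → ENNReal) :
    f (2 * σ) * ENNReal.ofReal (1 / c)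
      ≤ lineEnergy f (drop c σ) (viscositySolution (drop c σ)) := by
  set S := (fun s : ℝ => (s : ℂ)) '' Ioo 0 (1 / c) with hS
  have hSm : MeasurableSet S :=
    Complex.isometry_ofReal.isClosedEmbedding.measurableEmbedding.measurableSet_image.2
      measurableSet_Ioo
  have hae := h.viscositySolution_ae_eq
  have hmem : ∀ s ∈ Ioo 0 (1 / c), (s : ℂ) ∈ drop c σ := fun s hs => by
    show arcSupport c σ (s : ℂ) < 1
    rw [h.arcSupport_ofReal hs.1.le, mul_comm]
    exact (lt_div_iff₀ h.cos_pos).1 hs.2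
  have hsub : S ⊆ jumpSet (drop c σ) (viscositySolution (drop c σ)) := by
    rintro _ ⟨s, hs, rfl⟩
    exact ⟨hmem s hs, _, _, _,
      (hasJump_viscosityField h hs.1).congr hae h.isOpen_drop (hmem s hs)⟩
  refine le_trans ?_ (lintegral_mono_set hsub)
  have e : ENNReal.ofReal (1 / c) = (μH[1] : Measure ℂ) S := by
    rw [hS, hausdorffMeasure_ofReal_Ioo, sub_zero]
  rw [e, ← setLIntegral_const]
  refine setLIntegral_mono' hSm ?_
  rintro _ ⟨s, hs, rfl⟩
  have := jumpSize_congr hae h.isOpen_drop (hmem s hs)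
  rw [← this]
  exact (congrArg f (jumpSize_viscosityField h hs.1)).ge

/-! ### The jumps of the competitor -/

theorem competitor_eq_or (c σ : ℝ) (y : ℂ) :
    competitor c σ y = -(Complex.I * radial y) ∨
      competitor c σ y = Complex.I * arcNormal c σ y := by
  unfold competitor; split_ifs <;> simp

theorem competitor_eventuallyEq_vortex (h : IsAcutePair c σ) {x : ℂ}
    (hx : arcSupport c σ x + ‖x‖ < 2) :
    (fun y => -(Complex.I * radial y)) =ᶠ[𝓝 x] competitor c σ := by
  have hop : IsOpen {y : ℂ | arcSupport c σ y + ‖y‖ < 2} :=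
    isOpen_lt (h.continuous_arcSupport.add continuous_norm) continuous_const
  filter_upwards [hop.mem_nhds hx] with y hy
  exact (if_pos hy).symm

theorem competitor_eventuallyEq_arcNormal (h : IsAcutePair c σ) {x : ℂ}
    (hx : 2 < arcSupport c σ x + ‖x‖) :
    (fun y => Complex.I * arcNormal c σ y) =ᶠ[𝓝 x] competitor c σ := by
  have hop : IsOpen {y : ℂ | 2 < arcSupport c σ y + ‖y‖} :=
    isOpen_lt continuous_const (h.continuous_arcSupport.add continuous_norm)
  filter_upwards [hop.mem_nhds hx] with y hy
  exact (if_neg (not_lt.2 (le_of_lt hy))).symm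

/-- The ridge, where the two smooth pieces `1 - |x|` and `h - 1` meet. -/
def ridge (c σ : ℝ) : Set ℂ :=
  {x | x ∈ drop c σ ∧ arcSupport c σ x + ‖x‖ = 2 ∧ x.im ≠ 0}

theorem cone_of_mem_ridge {x : ℂ} (hx : x ∈ ridge c σ) : c * |x.im| ≤ σ * x.re := by
  by_contra hS
  obtain ⟨h1, h2, -⟩ := hx
  have h1' : arcSupport c σ x < 1 := h1
  rw [IsAcutePair.arcSupport_of_not_cone hS] at h1' h2
  linarith

/-- A jump excludes continuity. The ridge meets the axis where `c * s + s = 2`, that is at `2 / (1 +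
c)`; beyond it the old axial jump persists. The jump set is kept in the intersections because the
jump-size formulas assume a jump. -/
theorem jumpSet_competitor_subset (h : IsAcutePair c σ) :
    jumpSet (drop c σ) (competitor c σ) ⊆
      jumpSet (drop c σ) (competitor c σ) ∩ ridge c σ ∪
      (jumpSet (drop c σ) (competitor c σ)
        ∩ (fun s : ℝ => (s : ℂ)) '' Ioo (2 / (1 + c)) (1 / c) ∪
      {0, ((2 / (1 + c) : ℝ) : ℂ)}) := by
  intro x hxJ
  obtain ⟨hx, hj⟩ := id hxJ
  have hx1 : arcSupport c σ x < 1 := hx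
  have hcont : ¬ ContinuousAt (competitor c σ) x := fun hc =>
    not_hasJump_of_continuousAt (measurable_competitor h) (norm_competitor_le h) hc hj
  have hc1 : 0 < 1 + c := by linarith [h.cos_pos]
  have haxis : ¬ (x.im ≠ 0 ∨ x.re < 0) → ‖x‖ = x.re ∧ arcSupport c σ x = c * x.re ∧
      x = (x.re : ℂ) := fun h' => by
    push Not at h'
    have e := eq_ofReal_of_im_eq_zero h'.1
    refine ⟨?_, ?_, e⟩
    · conv_lhs => rw [e]
      rw [Complex.norm_real, Real.norm_of_nonneg h'.2]
    · conv_lhs => rw [e]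
      exact h.arcSupport_ofReal h'.2
  rcases lt_trichotomy (arcSupport c σ x + ‖x‖) 2 with hlt | heq | hgt
  · refine Or.inr (Or.inr (Or.inl ?_))
    by_contra h0
    exact hcont (ContinuousAt.congr (tendsto_neg_I_mul (continuousAt_radial h0))
      (competitor_eventuallyEq_vortex h hlt))
  · by_cases hi : x.im = 0
    · refine Or.inr (Or.inr (Or.inr ?_))
      have hre : ¬ (x.im ≠ 0 ∨ x.re < 0) := by
        rintro (h' | h')
        · exact h' hi
        · have hS : ¬ c * |x.im| ≤ σ * x.re := fun hS =>
            absurd (h.re_nonneg_of_cone hS) (not_le.2 h')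
          rw [IsAcutePair.arcSupport_of_not_cone hS] at hx1 heq
          linarith
      obtain ⟨e1, e2, e3⟩ := haxis hre
      rw [mem_singleton_iff, e3, Complex.ofReal_inj, eq_div_iff hc1.ne']
      rw [e1, e2] at heq
      linarith
    · exact Or.inl ⟨hxJ, hx, heq, hi⟩
  · refine Or.inr (Or.inl ⟨hxJ, ?_⟩)
    have hre : ¬ (x.im ≠ 0 ∨ x.re < 0) := fun h' =>
      hcont (((continuousAt_const (y := Complex.I)).mul (h.continuousAt_arcNormal h')).congr
        (competitor_eventuallyEq_arcNormal h hgt))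
    obtain ⟨e1, e2, e3⟩ := haxis hre
    rw [e1, e2] at hgt
    rw [e2] at hx1
    refine ⟨x.re, ⟨?_, ?_⟩, e3.symm⟩
    · rw [div_lt_iff₀ hc1]; linarith
    · rw [lt_div_iff₀ h.cos_pos]; linarith

theorem jumpSize_competitor_of_mem_ridge (h : IsAcutePair c σ) {x : ℂ}
    (hj : ∃ a b ν : ℂ, HasJump (competitor c σ) x a b ν) (hx : x ∈ ridge c σ) :
    jumpSize (competitor c σ) x ∈ Icc 1 2 := by
  have hx0 : x ≠ 0 := fun h0 => hx.2.2 (by simp [h0])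
  rw [jumpSize_eq (measurable_competitor h) (norm_competitor_le h) hj
    (u := -(Complex.I * radial x)) (v := Complex.I * arcNormal c σ x)]
  · have e : -(Complex.I * radial x) - Complex.I * arcNormal c σ x
        = -(Complex.I * (radial x + arcNormal c σ x)) := by ring
    rw [e, norm_neg, norm_mul, Complex.norm_I, one_mul]
    constructor
    · have h1 : ‖radial x + arcNormal c σ x‖ ^ 2
          = 2 + 2 * inner ℝ (radial x) (arcNormal c σ x) := by
        rw [norm_add_sq_real, norm_radial hx0, h.norm_arcNormal]; ring
      -- The inner product is `h / |x|`, so the two unit vectors form no obtuse angle and their sum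
      -- has norm at least `√2`. A bound away from `0` is what negative `p` requires.
      have h2 : 0 ≤ inner ℝ (radial x) (arcNormal c σ x) := by
        rw [radial, real_inner_smul_left, real_inner_comm]
        exact mul_nonneg (inv_nonneg.2 (norm_nonneg x)) (h.arcSupport_nonneg x)
      nlinarith [norm_nonneg (radial x + arcNormal c σ x)]
    · refine (norm_add_le _ _).trans ?_
      rw [norm_radial hx0, h.norm_arcNormal]
      norm_num
  · intro ε hε
    have hr : Tendsto (fun y => -(Complex.I * radial y)) (𝓝 x) (𝓝 (-(Complex.I * radial x))) :=
      tendsto_neg_I_mul (continuousAt_radial hx0)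
    have hn : Tendsto (fun y => Complex.I * arcNormal c σ y) (𝓝 x)
        (𝓝 (Complex.I * arcNormal c σ x)) :=
      (h.continuousAt_arcNormal (Or.inl hx.2.2)).tendsto.const_mul _
    filter_upwards [Metric.tendsto_nhds.1 hr ε hε, Metric.tendsto_nhds.1 hn ε hε] with y h1 h2
    rw [dist_eq_norm] at h1 h2
    rcases competitor_eq_or c σ y with e | e
    · left; rwa [e]
    · right; rwa [e]

theorem jumpSize_competitor_of_axis (h : IsAcutePair c σ) {s : ℝ} (hs : 2 / (1 + c) < s)
    (hj : ∃ a b ν : ℂ, HasJump (competitor c σ) s a b ν) :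
    jumpSize (competitor c σ) s = 2 * σ := by
  have hc1 : 0 < 1 + c := by linarith [h.cos_pos]
  have hs0 : 0 < s := lt_trans (by positivity) hs
  rw [div_lt_iff₀ hc1] at hs
  have hgt : 2 < arcSupport c σ (s : ℂ) + ‖(s : ℂ)‖ := by
    rw [h.arcSupport_ofReal hs0.le, Complex.norm_real, Real.norm_of_nonneg hs0.le]
    linarith
  rw [jumpSize_eq (measurable_competitor h) (norm_competitor_le h) hj
    (u := Complex.I * ⟨c, σ⟩) (v := Complex.I * ⟨c, -σ⟩)]
  · rw [← norm_corner_sub h, ← mul_sub, norm_mul, Complex.norm_I, one_mul]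
  · intro ε hε
    filter_upwards [eventually_cone h hs0, competitor_eventuallyEq_arcNormal h hgt] with y hy hy'
    rw [← hy']
    rcases arcNormal_eq_or hy with e | e
    · left; rw [e, sub_self, norm_zero]; exact hε
    · right; rw [e, sub_self, norm_zero]; exact hε

/-! ### The length of the ridge -/

/-- The parabola with focus `0` and axis `w`, where `x · w + |x| = 2`. -/
noncomputable def parabola (w : ℂ) (q : ℝ) : ℂ := w * ⟨1 - q ^ 2 / 4, q⟩

theorem eq_parabola {w x : ℂ} (hw : ‖w‖ = 1) (hx : inner ℝ w x + ‖x‖ = 2) :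
    x = parabola w (inner ℝ (Complex.I * w) x) := by
  have hw2 : w.re ^ 2 + w.im ^ 2 = 1 := by rw [← norm_sq_eq_re_im, hw, one_pow]
  have hx2 := norm_sq_eq_re_im x
  have hxn : ‖x‖ = 2 - inner ℝ w x := by linarith
  rw [hxn] at hx2
  have hp : inner ℝ w x = w.re * x.re + w.im * x.im := inner_eq_re_im w x
  have hq : inner ℝ (Complex.I * w) x = w.re * x.im - w.im * x.re := by
    rw [inner_eq_re_im]; simp; ring
  -- With coordinates `p` along `w` and `q` along `I * w`, the equation reads `p² + q² = (2 - p)²`,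
  -- so `p = 1 - q² / 4`.
  have key : 1 - (inner ℝ (Complex.I * w) x) ^ 2 / 4 = inner ℝ w x := by
    have : (inner ℝ (Complex.I * w) x) ^ 2 + (inner ℝ w x) ^ 2 = x.re ^ 2 + x.im ^ 2 := by
      rw [hp, hq]
      linear_combination (x.re ^ 2 + x.im ^ 2) * hw2
    linarith
  rw [parabola, key, hp, hq]
  apply Complex.ext
  · simp only [Complex.mul_re]
    linear_combination (-x.re) * hw2
  · simp only [Complex.mul_im]
    linear_combination (-x.im) * hw2

theorem hausdorffMeasure_parabola_le {w : ℂ} (hw : ‖w‖ = 1) {δ : ℝ} (hδ : δ ≤ 2) :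
    (μH[1] : Measure ℂ) (parabola w '' Icc (-δ) δ) ≤ ENNReal.ofReal (4 * δ) := by
  have hl : LipschitzOnWith 2 (parabola w) (Icc (-δ) δ) := by
    refine LipschitzOnWith.of_dist_le_mul fun q hq r hr => ?_
    have e : parabola w q - parabola w r = w * ((q - r : ℝ) • (⟨-(q + r) / 4, 1⟩ : ℂ)) := by
      rw [parabola, parabola, ← mul_sub]
      congr 1
      apply Complex.ext
      · simp; ring
      · simp
    rw [dist_eq_norm, e, norm_mul, hw, one_mul, norm_smul, Real.dist_eq, Real.norm_eq_abs, mul_comm]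
    gcongr
    refine (Complex.norm_le_abs_re_add_abs_im _).trans ?_
    have : |-(q + r) / 4| ≤ 1 := abs_le.2 ⟨by linarith [hq.2, hr.2], by linarith [hq.1, hr.1]⟩
    simp only [abs_one, NNReal.coe_ofNat]
    linarith
  refine (hl.hausdorffMeasure_image_le zero_le_one).trans ?_
  rw [hausdorffMeasure_real, Real.volume_Icc, ENNReal.rpow_one]
  rw [show 4 * δ = 2 * (δ - -δ) by ring, ENNReal.ofReal_mul zero_le_two]
  simp

/-- The parabola parameter is `c * im x ∓ σ * re x`. In the cone it is bounded by `σ * re x`, hence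
by `2σ`: the ridge is short because the cone is thin. -/
theorem ridge_subset (h : IsAcutePair c σ) :
    ridge c σ ⊆ parabola ⟨c, σ⟩ '' Icc (-(2 * σ)) (2 * σ)
      ∪ parabola ⟨c, -σ⟩ '' Icc (-(2 * σ)) (2 * σ) := by
  intro x hx
  have hS := cone_of_mem_ridge hx
  have h2 := hx.2.1
  have hre0 := h.re_nonneg_of_cone hS
  have hre2 : x.re ≤ 2 := by
    have := h.arcSupport_nonneg x
    have := (le_abs_self _).trans (Complex.abs_re_le_norm x)
    linarith
  have hσ := h.sin_pos
  have hc := h.cos_pos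
  have hin : arcSupport c σ x = inner ℝ (corner c σ x) x := by
    rw [inner_corner_self, IsAcutePair.arcSupport_of_cone hS]
  rw [hin] at h2
  have hpar := eq_parabola (h.norm_corner x) h2
  have hm := mul_le_mul_of_nonneg_left hre2 hσ.le
  by_cases hi : 0 ≤ x.im
  · left
    rw [corner, if_pos hi] at hpar
    refine ⟨_, ?_, hpar.symm⟩
    rw [abs_of_nonneg hi] at hS
    have hq : inner ℝ (Complex.I * (⟨c, σ⟩ : ℂ)) x = c * x.im - σ * x.re := by
      rw [inner_eq_re_im]; simp; ring
    rw [hq]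
    have := mul_nonneg hc.le hi
    exact ⟨by linarith, by linarith⟩
  · right
    rw [corner, if_neg hi] at hpar
    refine ⟨_, ?_, hpar.symm⟩
    rw [abs_of_neg (not_le.1 hi)] at hS
    have hq : inner ℝ (Complex.I * (⟨c, -σ⟩ : ℂ)) x = c * x.im + σ * x.re := by
      rw [inner_eq_re_im]; simp; ring
    rw [hq]
    have := mul_nonneg hc.le (neg_nonneg.2 (not_le.1 hi).le)
    exact ⟨by linarith, by linarith⟩

theorem hausdorffMeasure_ridge_le (h : IsAcutePair c σ) :
    (μH[1] : Measure ℂ) (ridge c σ) ≤ ENNReal.ofReal (16 * σ) := by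
  have hσ1 : 2 * σ ≤ 2 := by nlinarith [h.sq_add_sq, sq_nonneg c, h.sin_pos]
  have hσ := h.sin_pos
  have n1 : ‖(⟨c, σ⟩ : ℂ)‖ = 1 := by
    simpa [corner] using h.norm_corner (0 : ℂ)
  have n2 : ‖(⟨c, -σ⟩ : ℂ)‖ = 1 := by
    have := h.norm_corner (-Complex.I)
    rwa [corner, if_neg (by norm_num)] at this
  refine (measure_mono (ridge_subset h)).trans ((measure_union_le _ _).trans ?_)
  refine (add_le_add (hausdorffMeasure_parabola_le n1 hσ1)
    (hausdorffMeasure_parabola_le n2 hσ1)).trans ?_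
  rw [← ENNReal.ofReal_add (by positivity) (by positivity)]
  exact ENNReal.ofReal_le_ofReal (by linarith)

theorem lineEnergy_competitor_le (h : IsAcutePair c σ) {f : ℝ → ENNReal} {M : ENNReal}
    (hM : ∀ t ∈ Icc (1 : ℝ) 2, f t ≤ M) :
    lineEnergy f (drop c σ) (competitor c σ) ≤ M * ENNReal.ofReal (16 * σ)
      + f (2 * σ) * ENNReal.ofReal (1 / c - 2 / (1 + c)) := by
  set J := jumpSet (drop c σ) (competitor c σ) with hJ
  set S := (fun s : ℝ => (s : ℂ)) '' Ioo (2 / (1 + c)) (1 / c) with hS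
  have hfin : ∫⁻ x in ({0, ((2 / (1 + c) : ℝ) : ℂ)} : Set ℂ), f (jumpSize (competitor c σ) x)
      ∂(μH[1] : Measure ℂ) = 0 := by
    refine setLIntegral_measure_zero _ _ ?_
    exact measure_eq_zero_iff_ae_notMem.2 (ae_hausdorffMeasure_of_countable (Set.to_countable _))
  have h1 : ∫⁻ x in J ∩ ridge c σ, f (jumpSize (competitor c σ) x) ∂(μH[1] : Measure ℂ)
      ≤ M * ENNReal.ofReal (16 * σ) := by
    refine (setLIntegral_mono (g := fun _ => M) measurable_const fun x hx =>
      hM _ (jumpSize_competitor_of_mem_ridge h hx.1.2 hx.2)).trans ?_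
    rw [setLIntegral_const]
    gcongr
    exact (measure_mono inter_subset_right).trans (hausdorffMeasure_ridge_le h)
  have h2 : ∫⁻ x in J ∩ S, f (jumpSize (competitor c σ) x) ∂(μH[1] : Measure ℂ)
      ≤ f (2 * σ) * ENNReal.ofReal (1 / c - 2 / (1 + c)) := by
    refine (setLIntegral_mono (g := fun _ => f (2 * σ)) measurable_const ?_).trans ?_
    · rintro _ ⟨hx, s, hs, rfl⟩
      exact (congrArg f (jumpSize_competitor_of_axis h hs.1 hx.2)).le
    · rw [setLIntegral_const]
      gcongr
      rw [← hausdorffMeasure_ofReal_Ioo]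
      exact measure_mono inter_subset_right
  refine (lintegral_mono_set (jumpSet_competitor_subset h)).trans ?_
  refine (lintegral_union_le _ _ _).trans (add_le_add h1 ?_)
  refine (lintegral_union_le _ _ _).trans ?_
  rw [hfin, add_zero]
  exact h2

end

/-! ### Comparison -/

theorem powerCost_le (p : ℝ) {t : ℝ} (ht : t ∈ Icc (1 : ℝ) 2) :
    powerCost p t ≤ ENNReal.ofReal (2 ^ |p|) := by
  have ht0 : 0 < t := lt_of_lt_of_le zero_lt_one ht.1
  rw [powerCost, ENNReal.ofReal_rpow_of_pos ht0]
  refine ENNReal.ofReal_le_ofReal ?_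
  calc t ^ p ≤ t ^ |p| := Real.rpow_le_rpow_of_exponent_le ht.1 (le_abs_self p)
    _ ≤ 2 ^ |p| := Real.rpow_le_rpow ht0.le ht.2 (abs_nonneg p)

theorem lineEnergy_competitor_lt {c σ p : ℝ} (h : IsAcutePair c σ)
    (hp : 2 ^ |p| * 8 * (2 * σ) ^ (1 - p) < 1) :
    lineEnergy (powerCost p) (drop c σ) (competitor c σ)
      < lineEnergy (powerCost p) (drop c σ) (viscositySolution (drop c σ)) := by
  have hσ := h.sin_pos
  have hc := h.cos_pos
  have hc1 : c ≤ 1 := by nlinarith [h.sq_add_sq, sq_nonneg σ]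
  have h2σ : 0 < 2 * σ := by linarith
  have hP : 0 < (2 * σ) ^ p := Real.rpow_pos_of_pos h2σ p
  have hcost : powerCost p (2 * σ) = ENNReal.ofReal ((2 * σ) ^ p) := by
    rw [powerCost, ENNReal.ofReal_rpow_of_pos h2σ]
  have hlen : 0 ≤ 1 / c - 2 / (1 + c) := by
    rw [sub_nonneg, div_le_div_iff₀ (by linarith) hc]; linarith
  refine (lineEnergy_competitor_le h fun t ht => powerCost_le p ht).trans_lt
    (lt_of_lt_of_le ?_ (le_lineEnergy_viscositySolution h _))
  rw [hcost, ← ENNReal.ofReal_mul (by positivity), ← ENNReal.ofReal_mul hP.le,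
    ← ENNReal.ofReal_mul hP.le, ← ENNReal.ofReal_add (by positivity) (mul_nonneg hP.le hlen)]
  refine (ENNReal.ofReal_lt_ofReal_iff (by positivity)).2 ?_
  have hmul : (2 * σ) ^ (1 - p) * (2 * σ) ^ p = 2 * σ := by
    rw [← Real.rpow_add h2σ, sub_add_cancel, Real.rpow_one]
  have hone : 1 ≤ 2 / (1 + c) := by
    rw [le_div_iff₀ (by linarith)]; linarith
  -- Multiply `hp` by `(2 * σ) ^ p`: the cost of the ridge is below one unit `(2 * σ) ^ p`, while
  -- the axis saves `2 / (1 + c) ≥ 1` such units.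
  have h1 : 2 ^ |p| * (16 * σ) < (2 * σ) ^ p := by
    have := mul_lt_mul_of_pos_right hp hP
    rw [mul_assoc, hmul, one_mul] at this
    linarith
  have h2 : (2 * σ) ^ p ≤ (2 * σ) ^ p * (2 / (1 + c)) := le_mul_of_one_le_right hP.le hone
  rw [mul_sub]
  linarith

theorem exists_small_angle {p : ℝ} (hp : p < 1) :
    ∃ δ : ℝ, 0 < δ ∧ ∀ s, 0 < s → s < δ → 2 ^ |p| * 8 * (2 * s) ^ (1 - p) < 1 := by
  have hcont : Tendsto (fun s : ℝ => 2 ^ |p| * 8 * (2 * s) ^ (1 - p)) (𝓝 0)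
      (𝓝 (2 ^ |p| * 8 * (2 * 0) ^ (1 - p))) :=
    (Continuous.mul continuous_const ((continuous_const.mul continuous_id).rpow_const
      fun _ => Or.inr (by linarith))).tendsto 0
  rw [mul_zero, Real.zero_rpow (by linarith), mul_zero] at hcont
  obtain ⟨δ, hδ, h⟩ := Metric.eventually_nhds_iff.1 (hcont.eventually_lt_const zero_lt_one)
  refine ⟨δ, hδ, fun s hs hsδ => h ?_⟩
  rwa [dist_zero_right, Real.norm_of_nonneg hs.le]

theorem isAcutePair_of_angle {θ : ℝ} (h0 : θ ≠ 0) (hθ : |θ| < Real.pi / 2) :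
    IsAcutePair (Real.cos θ) |Real.sin θ| where
  cos_pos := Real.cos_pos_of_mem_Ioo (abs_lt.1 hθ)
  sin_pos := by
    refine abs_pos.2 fun hs => h0 ?_
    have := abs_lt.1 hθ
    exact (Real.sin_eq_zero_iff_of_lt_of_lt (by linarith [Real.pi_pos])
      (by linarith [Real.pi_pos])).1 hs
  sq_add_sq := by rw [sq_abs]; exact Real.cos_sq_add_sin_sq θ

end LineEnergy

theorem mainTheorem4 (p : ℝ) (hp : p < 1) :
    ∃ θ₀ : ℝ, 0 < θ₀ ∧ θ₀ < Real.pi / 2 ∧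
      ∀ θ : ℝ, θ ≠ 0 → |θ| < θ₀ →
        LineEnergy.viscositySolution (LineEnergy.dropDomain θ) ∈
            LineEnergy.tangentFieldSet (LineEnergy.dropDomain θ) ∧
          ¬ LineEnergy.IsMinimizer (LineEnergy.powerCost p) (LineEnergy.dropDomain θ)
            (LineEnergy.viscositySolution (LineEnergy.dropDomain θ)) := by
  obtain ⟨δ, hδ, hsmall⟩ := LineEnergy.exists_small_angle hp
  have hpi := Real.pi_gt_three
  -- The bound `1` keeps the angle below `π / 2`; `δ` controls `σ` through `|sin θ| ≤ |θ|`.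
  refine ⟨min δ 1, lt_min hδ one_pos, (min_le_right _ _).trans_lt (by linarith), ?_⟩
  intro θ h0 hθ
  have hθδ : |θ| < δ := hθ.trans_le (min_le_left _ _)
  have h := LineEnergy.isAcutePair_of_angle h0
    ((hθ.trans_le (min_le_right _ _)).trans (by linarith))
  rw [LineEnergy.dropDomain_eq_drop h]
  refine ⟨LineEnergy.mem_tangentFieldSet_congr h.viscositySolution_ae_eq
    (LineEnergy.viscosityField_mem_tangentFieldSet h), fun hmin => ?_⟩
  have hlt := LineEnergy.lineEnergy_competitor_lt h
    (hsmall _ h.sin_pos ((Real.abs_sin_le_abs).trans_lt hθδ))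
  exact absurd (hmin.2 _ (LineEnergy.competitor_mem_tangentFieldSet h)) (not_le.2 hlt)
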